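/- Let $Q_1,Q_2,Q_3\in\mathbb R[u,v,w]$ be quadratic forms such that $\Delta=(Q_1Q_3-Q_2^2=0)\subset\mathbb P^2$ is a smooth plane quartic curve (smooth over $\mathbb C$), and let $Y\to\mathbb P^1_{[t_0:t_1]}\times\mathbb P^2_{[u:v:w]}$ be the double cover defined by \[z^2=t_0^2Q_1+2t_0t_1Q_2+t_1^2Q_3 .\] Equip $Y(\mathbb R)$ and $\mathbb P^2(\mathbb R)$ with the Euclidean topology. An oval is a simple closed curve in $\mathbb P^2(\mathbb R)$ that bounds an embedded closed disc. Ovals are non-nested if they bound pairwise disjoint closed discs, and two ovals are nested if the closed disc bounded by one is contained in the open disc bounded by the other. If $Y(\mathbb R)$ is disconnected (that is, has at least two connected components), then $\Delta(\mathbb R)$ is the disjoint union of two ovals (nested or non-nested) or of three non-nested ovals. More precisely: \begin{enumerate} \item if $Y(\mathbb R)$ has exactly three connected components, then $\Delta(\mathbb R)$ is the disjoint union of three non-nested ovals; \item if $Y(\mathbb R)$ has exactly two connected components, then $\Delta(\mathbb R)$ is the disjoint union of two ovals, which are either non-nested or nested. \end{enumerate} -/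

import Mathlib

open scoped LinearAlgebra.Projectivization

/-- The real projective plane `ℙ²(ℝ)`. -/
abbrev RP2 : Type := ℙ ℝ (Fin 3 → ℝ)

/-- The Euclidean topology on `ℙ²(ℝ)`: the quotient topology from `ℝ³ ∖ {0}`. -/
instance RP2.instTopologicalSpace : TopologicalSpace RP2 :=
  inferInstanceAs (TopologicalSpace (Quotient (projectivizationSetoid ℝ (Fin 3 → ℝ))))

/-- The discriminant form `Q₁ Q₃ - Q₂²`. -/
noncomputable def discrForm (Q₁ Q₂ Q₃ : MvPolynomial (Fin 3) ℝ) : MvPolynomial (Fin 3) ℝ :=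
  Q₁ * Q₃ - Q₂ ^ 2

/-- The projective plane curve `f = 0` is smooth: at no complex point of the curve do all
partial derivatives of `f` vanish. -/
def IsSmoothPlaneCurve (f : MvPolynomial (Fin 3) ℝ) : Prop :=
  ∀ p : Fin 3 → ℂ, p ≠ 0 → MvPolynomial.aeval p f = 0 →
    ∃ i, MvPolynomial.aeval p (MvPolynomial.pderiv i f) ≠ 0

/-- The set of real points of the projective plane curve `f = 0` (for `f` homogeneous). -/
def realLocus (f : MvPolynomial (Fin 3) ℝ) : Set RP2 :=
  {p | MvPolynomial.eval p.rep f = 0}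

/-- Coordinates `(t, x, z)` of the real points of the double cover
`z² = t₀² Q₁(x) + 2 t₀ t₁ Q₂(x) + t₁² Q₃(x)` of `ℙ¹ × ℙ²`. -/
def DoubleCoverCoords (Q₁ Q₂ Q₃ : MvPolynomial (Fin 3) ℝ) : Type :=
  {p : (Fin 2 → ℝ) × (Fin 3 → ℝ) × ℝ // p.1 ≠ 0 ∧ p.2.1 ≠ 0 ∧
    p.2.2 ^ 2 = p.1 0 ^ 2 * MvPolynomial.eval p.2.1 Q₁
      + 2 * p.1 0 * p.1 1 * MvPolynomial.eval p.2.1 Q₂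
      + p.1 1 ^ 2 * MvPolynomial.eval p.2.1 Q₃}

instance (Q₁ Q₂ Q₃ : MvPolynomial (Fin 3) ℝ) : TopologicalSpace (DoubleCoverCoords Q₁ Q₂ Q₃) :=
  instTopologicalSpaceSubtype

/-- `(t, x, z)` and `(a t, b x, a b z)`, with `a, b` nonzero reals, are coordinates of the same
point: `z` is a fibre coordinate of the line bundle `𝒪(1,1)` on `ℙ¹ × ℙ²`. -/
def doubleCoverSetoid (Q₁ Q₂ Q₃ : MvPolynomial (Fin 3) ℝ) :
    Setoid (DoubleCoverCoords Q₁ Q₂ Q₃) where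
  r p q := ∃ a b : ℝˣ, q.1.1 = (a : ℝ) • p.1.1 ∧ q.1.2.1 = (b : ℝ) • p.1.2.1 ∧
    q.1.2.2 = (a : ℝ) * b * p.1.2.2
  iseqv :=
    { refl := fun p => ⟨1, 1, by simp, by simp, by simp⟩
      symm := by
        rintro p q ⟨a, b, h₁, h₂, h₃⟩
        refine ⟨a⁻¹, b⁻¹, ?_, ?_, ?_⟩
        · simp [h₁, smul_smul]
        · simp [h₂, smul_smul]
        · have ha := a.ne_zero
          have hb := b.ne_zero
          simp only [h₃, Units.val_inv_eq_inv_val]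
          field_simp
      trans := by
        rintro p q r ⟨a, b, h₁, h₂, h₃⟩ ⟨c, d, k₁, k₂, k₃⟩
        refine ⟨c * a, d * b, ?_, ?_, ?_⟩
        · simp [h₁, k₁, smul_smul]
        · simp [h₂, k₂, smul_smul]
        · rw [k₃, h₃]
          push_cast
          ring }

/-- The real locus `Y(ℝ)` of the double cover `Y → ℙ¹ × ℙ²` given by
`z² = t₀² Q₁ + 2 t₀ t₁ Q₂ + t₁² Q₃`. -/
def DoubleCover (Q₁ Q₂ Q₃ : MvPolynomial (Fin 3) ℝ) : Type :=
  Quotient (doubleCoverSetoid Q₁ Q₂ Q₃)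

/-- The Euclidean topology on `Y(ℝ)`: the quotient topology. -/
instance (Q₁ Q₂ Q₃ : MvPolynomial (Fin 3) ℝ) : TopologicalSpace (DoubleCover Q₁ Q₂ Q₃) :=
  inferInstanceAs (TopologicalSpace (Quotient (doubleCoverSetoid Q₁ Q₂ Q₃)))

/-- The closed unit disc in the Euclidean plane. -/
abbrev ClosedDisc : Type := Metric.closedBall (0 : EuclideanSpace ℝ (Fin 2)) 1

/-- The boundary curve of a parametrized closed disc in `ℙ²(ℝ)`. When the parametrization `φ` is
a topological embedding, this curve is an oval, and its inside is `discInterior φ`. -/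
def discBoundary (φ : ClosedDisc → RP2) : Set RP2 :=
  φ '' {x | ‖(x : EuclideanSpace ℝ (Fin 2))‖ = 1}

/-- The open part of a parametrized closed disc in `ℙ²(ℝ)`. -/
def discInterior (φ : ClosedDisc → RP2) : Set RP2 :=
  φ '' {x | ‖(x : EuclideanSpace ℝ (Fin 2))‖ < 1}

/-- `S` consists of `n` mutually disjoint ovals, none of which lies inside another: `S` is the
union of the boundary curves of `n` pairwise disjoint embedded closed discs. -/
def IsNonNestedOvals (n : ℕ) (S : Set RP2) : Prop :=
  ∃ φ : Fin n → ClosedDisc → RP2, (∀ i, Topology.IsEmbedding (φ i)) ∧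
    (∀ i j, i ≠ j → Disjoint (Set.range (φ i)) (Set.range (φ j))) ∧
    S = ⋃ i, discBoundary (φ i)

/-- `S` consists of two disjoint ovals, one of which lies inside the other. -/
def IsTwoNestedOvals (S : Set RP2) : Prop :=
  ∃ φ ψ : ClosedDisc → RP2, Topology.IsEmbedding φ ∧ Topology.IsEmbedding ψ ∧
    Set.range φ ⊆ discInterior ψ ∧ S = discBoundary φ ∪ discBoundary ψ

/-!
Write `q_t = t₀² Q₁ + 2 t₀ t₁ Q₂ + t₁² Q₃` and `D = Q₁ Q₃ - Q₂²`. The projection of `Y(ℝ)` to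
`ℙ²(ℝ)` has connected fibres, so its image, the set where some `q_t` is nonnegative, has the same
components as `Y(ℝ)`. Every set `q_t ≥ 0` is connected in `ℙ²(ℝ)`. If the image is disconnected, it
follows that some `q_τ` is negative definite, and the image is then the set `D ≤ 0`. Move `t` once
around `ℙ¹(ℝ)`, starting from `τ`: for each component `q_t` degenerates at least twice, on ceasing
to be negative definite and on becoming so again. Since `det q_t` has degree six in `t`, there are
at most three components.

Let `C` be a component and `e` a point with `D(e) < 0` of another component `C'`. On a line through
`e` the quartic `D` has at most four zeros, two of which bound the interval around `e`, so the line
meets `C` in at most one interval. If some line through `e` misses `C`, then `C` is a disc, namely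
the region between two graphs over the pencil of lines through `e`. Otherwise `C` is a Möbius band.
Its complement is an open disc which is star-shaped about `e`, and `C'` is a closed disc inside it,
again star-shaped about `e`: this is the case of two nested ovals.
-/

open Set Filter Topology

/-- A quadratic family `q_t = t₀² B₁ + 2 t₀ t₁ B₂ + t₁² B₃`, `t ∈ ℝ²`, of quadratic forms on `V`,
given by symmetric bilinear forms. -/
structure QuadricFamily (V : Type*) [AddCommGroup V] [Module ℝ V] where
  B₁ : LinearMap.BilinForm ℝ V
  B₂ : LinearMap.BilinForm ℝ V
  B₃ : LinearMap.BilinForm ℝ V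
  symm₁ : B₁.IsSymm
  symm₂ : B₂.IsSymm
  symm₃ : B₃.IsSymm

namespace QuadricFamily

section Algebra

variable {V : Type*} [AddCommGroup V] [Module ℝ V] (P : QuadricFamily V)

/-- The symmetric bilinear form of the member `q_t` of the family. -/
def bilin (t : Fin 2 → ℝ) : LinearMap.BilinForm ℝ V :=
  t 0 ^ 2 • P.B₁ + (2 * t 0 * t 1) • P.B₂ + t 1 ^ 2 • P.B₃

/-- The discriminant `B₁(x, x) B₃(x, x) - B₂(x, x)²`, a quartic form. -/
def discr (x : V) : ℝ := P.B₁ x x * P.B₃ x x - P.B₂ x x ^ 2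

/-- Half of the derivative of the discriminant at `x` in the direction `v`. -/
def discrDeriv (x v : V) : ℝ :=
  P.B₁ x v * P.B₃ x x + P.B₁ x x * P.B₃ x v - 2 * P.B₂ x x * P.B₂ x v

/-- The slope of the discriminant between `x` and `x + s v`, written as a polynomial in `s` so that
it is continuous at `s = 0`. -/
def slope (x v : V) (s : ℝ) : ℝ :=
  2 * P.discrDeriv x v
    + (P.B₁ x x * P.B₃ v v + P.B₁ v v * P.B₃ x x + 4 * P.B₁ x v * P.B₃ x v
        - 4 * P.B₂ x v ^ 2 - 2 * P.B₂ x x * P.B₂ v v) * s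
    + 2 * P.discrDeriv v x * s ^ 2 + P.discr v * s ^ 3

/-- The discriminant hypersurface has no singular point over `ℝ`. -/
def Smooth : Prop := ∀ p, p ≠ 0 → P.discr p = 0 → ∃ v, P.discrDeriv p v ≠ 0

/-- The cone over the projection of the double cover `z² = q_t(x)`. -/
def base : Set V := {x | ∃ t, t ≠ 0 ∧ 0 ≤ P.bilin t x x}

/-- The member `q_t` is negative definite. -/
def NegDef (t : Fin 2 → ℝ) : Prop := ∀ x, x ≠ 0 → P.bilin t x x < 0

theorem bilin_apply (t : Fin 2 → ℝ) (x y : V) :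
    P.bilin t x y = t 0 ^ 2 * P.B₁ x y + 2 * t 0 * t 1 * P.B₂ x y + t 1 ^ 2 * P.B₃ x y := rfl

theorem isSymm_bilin (t : Fin 2 → ℝ) : (P.bilin t).IsSymm where
  eq x y := by
    simp only [bilin_apply, P.symm₁.eq x y, P.symm₂.eq x y, P.symm₃.eq x y]

theorem bilin_smul (c : ℝ) (t : Fin 2 → ℝ) : P.bilin (c • t) = c ^ 2 • P.bilin t := by
  ext x y
  simp only [bilin_apply, Pi.smul_apply, LinearMap.smul_apply, smul_eq_mul]
  ring

theorem discr_zero : P.discr 0 = 0 := by simp [discr]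

theorem discr_smul (c : ℝ) (x : V) : P.discr (c • x) = c ^ 4 * P.discr x := by
  simp only [discr, map_smul, LinearMap.smul_apply, smul_eq_mul]
  ring

theorem discrDeriv_add (x v w : V) :
    P.discrDeriv x (v + w) = P.discrDeriv x v + P.discrDeriv x w := by
  simp only [discrDeriv, map_add]
  ring

theorem discrDeriv_smul (x v : V) (c : ℝ) : P.discrDeriv x (c • v) = c * P.discrDeriv x v := by
  simp only [discrDeriv, map_smul, smul_eq_mul]
  ring

theorem discrDeriv_self (x : V) : P.discrDeriv x x = 2 * P.discr x := by
  simp only [discrDeriv, discr]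
  ring

theorem slope_zero (x v : V) : P.slope x v 0 = 2 * P.discrDeriv x v := by simp [slope]

theorem discr_add_smul (x v : V) (s : ℝ) :
    P.discr (x + s • v) = P.discr x + s * P.slope x v s := by
  simp only [discr, slope, discrDeriv, map_add, map_smul, LinearMap.add_apply,
    LinearMap.smul_apply, smul_eq_mul, show P.B₁ v x = P.B₁ x v from P.symm₁.eq v x,
    show P.B₂ v x = P.B₂ x v from P.symm₂.eq v x, show P.B₃ v x = P.B₃ x v from P.symm₃.eq v x]
  ring

end Algebra

section Continuity

variable {V X : Type*} [NormedAddCommGroup V] [NormedSpace ℝ V] [FiniteDimensional ℝ V]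
  [TopologicalSpace X] (P : QuadricFamily V)

@[fun_prop]
theorem continuous_bilinForm_apply (B : LinearMap.BilinForm ℝ V) {f g : X → V}
    (hf : Continuous f) (hg : Continuous g) : Continuous fun a => B (f a) (g a) :=
  (LinearMap.toContinuousBilinearMap B).continuous₂.comp (hf.prodMk hg)

@[fun_prop]
theorem continuous_bilin {t : X → Fin 2 → ℝ} {f g : X → V} (ht : Continuous t) (hf : Continuous f)
    (hg : Continuous g) : Continuous fun a => P.bilin (t a) (f a) (g a) := by
  simp only [bilin_apply]
  fun_prop

@[fun_prop]
theorem continuous_discr : Continuous P.discr := by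
  unfold discr
  fun_prop

@[fun_prop]
theorem continuous_slope {f g : X → V} {r : X → ℝ} (hf : Continuous f) (hg : Continuous g)
    (hr : Continuous r) : Continuous fun a => P.slope (f a) (g a) (r a) := by
  unfold slope discrDeriv
  fun_prop

end Continuity

end QuadricFamily

theorem mem_biUnion_compl_singleton {ι α : Type*} {C : ι → Set α} {i j : ι} (hij : i ≠ j) {x : α}
    (hx : x ∈ C j) : x ∈ ⋃ k ∈ ({i}ᶜ : Set ι), C k :=
  mem_biUnion (show j ∈ ({i}ᶜ : Set ι) from hij.symm) hx

section Segment

variable {V : Type*} [AddCommGroup V] [Module ℝ V] {x y z : V}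

theorem exists_eq_smul_of_zero_mem_segment (hx : x ≠ 0) (h : (0 : V) ∈ segment ℝ x y) :
    ∃ c : ℝ, y = c • x := by
  rw [mem_segment_iff_sameRay, zero_sub, sub_zero] at h
  obtain ⟨r, -, hr⟩ := h.exists_nonneg_left (neg_ne_zero.mpr hx)
  exact ⟨-r, by rw [← hr, smul_neg, neg_smul]⟩

theorem bilinForm_nonneg_of_mem_segment {q : LinearMap.BilinForm ℝ V} (hq : q.IsSymm)
    (hx : 0 ≤ q x x) (hy : 0 ≤ q y y) (hxy : 0 ≤ q x y) (hz : z ∈ segment ℝ x y) : 0 ≤ q z z := by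
  obtain ⟨a, b, ha, hb, -, rfl⟩ := hz
  have hyx : q y x = q x y := hq.eq y x
  simp only [map_add, map_smul, LinearMap.add_apply, LinearMap.smul_apply, smul_eq_mul, hyx]
  positivity

end Segment

section Cones

variable {ι V : Type*} [AddCommGroup V] [Module ℝ V] [TopologicalSpace V] {B C C' : Set V}

/-- A closed set that is stable under all real scalars, such as the cone over a closed subset of
the projective space of `V`. -/
structure IsProjCone (C : Set V) : Prop where
  isClosed : IsClosed C
  smul_mem : ∀ c : ℝ, ∀ x ∈ C, c • x ∈ C

/-- `B` is the union of two cones over disjoint closed subsets of projective space. -/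
structure ConeSplit (B C C' : Set V) : Prop where
  left : IsProjCone C
  right : IsProjCone C'
  eq_zero : ∀ x ∈ C, x ∈ C' → x = 0
  union : C ∪ C' = B

/-- `B` is the union of the cones over a family of pairwise disjoint nonempty closed subsets of
projective space. -/
structure ConePartition (B : Set V) (C : ι → Set V) : Prop where
  isProjCone : ∀ i, IsProjCone (C i)
  eq_zero : ∀ i j, i ≠ j → ∀ x ∈ C i, x ∈ C j → x = 0
  iUnion : ⋃ i, C i = B
  nontrivial : ∀ i, ∃ x ∈ C i, x ≠ 0

theorem isProjCone_univ : IsProjCone (univ : Set V) := ⟨isClosed_univ, fun _ _ _ => mem_univ _⟩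

theorem IsProjCone.biUnion {C : ι → Set V} {S : Set ι} (hS : S.Finite)
    (hC : ∀ i, IsProjCone (C i)) : IsProjCone (⋃ i ∈ S, C i) where
  isClosed := hS.isClosed_biUnion fun i _ => (hC i).isClosed
  smul_mem c x hx := by
    obtain ⟨i, hi, hxi⟩ := mem_iUnion₂.mp hx
    exact mem_biUnion hi ((hC i).smul_mem c x hxi)

theorem ConePartition.split [Finite ι] {C : ι → Set V} (h : ConePartition B C) (S : Set ι) :
    ConeSplit B (⋃ i ∈ S, C i) (⋃ i ∈ Sᶜ, C i) where
  left := .biUnion S.toFinite h.isProjCone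
  right := .biUnion Sᶜ.toFinite h.isProjCone
  eq_zero x hx hx' := by
    obtain ⟨i, hi, hxi⟩ := mem_iUnion₂.mp hx
    obtain ⟨j, hj, hxj⟩ := mem_iUnion₂.mp hx'
    exact h.eq_zero i j (ne_of_mem_of_not_mem hi hj) x hxi hxj
  union := by rw [← biUnion_union, union_compl_self, biUnion_univ, h.iUnion]

theorem ConePartition.split_singleton [Finite ι] {C : ι → Set V} (h : ConePartition B C) (i : ι) :
    ConeSplit B (C i) (⋃ j ∈ ({i}ᶜ : Set ι), C j) := by
  simpa only [biUnion_singleton] using h.split {i}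

namespace ConeSplit

theorem subset_left (h : ConeSplit B C C') : C ⊆ B := h.union ▸ subset_union_left

theorem subset_right (h : ConeSplit B C C') : C' ⊆ B := h.union ▸ subset_union_right

theorem mem_or_mem (h : ConeSplit B C C') {x : V} (hx : x ∈ B) : x ∈ C ∨ x ∈ C' := by
  rwa [← h.union] at hx

theorem notMem_right_of_isPreconnected (h : ConeSplit B C C') {S : Set V} (hS : IsPreconnected S)
    (hSB : S ⊆ B) (h0 : (0 : V) ∉ S) {x y : V} (hx : x ∈ S) (hxC : x ∈ C) (hy : y ∈ S) :
    y ∉ C' := by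
  intro hyC
  obtain ⟨z, hz, hzC, hzC'⟩ := isPreconnected_closed_iff.mp hS C C' h.left.isClosed
    h.right.isClosed (h.union ▸ hSB) ⟨x, hx, hxC⟩ ⟨y, hy, hyC⟩
  exact h0 (h.eq_zero z hzC hzC' ▸ hz)

theorem zero_notMem_segment (h : ConeSplit B C C') {x y : V} (hxC : x ∈ C) (hx0 : x ≠ 0)
    (hyC : y ∈ C') (hy0 : y ≠ 0) : (0 : V) ∉ segment ℝ x y := by
  intro h0
  obtain ⟨c, rfl⟩ := exists_eq_smul_of_zero_mem_segment hx0 h0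
  exact hy0 (h.eq_zero _ (h.left.smul_mem c x hxC) hyC)

/- After replacing `y` by `-y` the form is nonnegative on the whole segment from `x` to `y`: the
projective set where a quadratic form is nonnegative is connected. -/
theorem bilinForm_neg [ContinuousAdd V] [ContinuousSMul ℝ V] (h : ConeSplit B C C')
    {q : LinearMap.BilinForm ℝ V} (hq : q.IsSymm) (hqB : {x | 0 ≤ q x x} ⊆ B) {x y : V}
    (hxC : x ∈ C) (hx0 : x ≠ 0) (hx : 0 ≤ q x x) (hyC : y ∈ C') (hy0 : y ≠ 0) : q y y < 0 := by
  by_contra! hy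
  wlog hxy : 0 ≤ q x y generalizing y
  · refine this (y := -y) ?_ (neg_ne_zero.mpr hy0) ?_ ?_
    · simpa only [neg_one_smul] using h.right.smul_mem (-1) y hyC
    · simpa only [map_neg, LinearMap.neg_apply, neg_neg] using hy
    · simpa only [map_neg, Left.nonneg_neg_iff] using (not_le.mp hxy).le
  refine h.notMem_right_of_isPreconnected (convex_segment x y).isPreconnected ?_
    (h.zero_notMem_segment hxC hx0 hyC hy0) (left_mem_segment ℝ x y) hxC
    (right_mem_segment ℝ x y) hyC
  exact fun z hz => hqB (bilinForm_nonneg_of_mem_segment hq hx hy hxy hz)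

end ConeSplit

end Cones

namespace QuadricFamily

section Base

variable {V : Type*} [AddCommGroup V] [Module ℝ V] {P : QuadricFamily V} {τ : Fin 2 → ℝ}

theorem NegDef.smul (hτ : P.NegDef τ) {c : ℝ} (hc : c ≠ 0) : P.NegDef (c • τ) := fun x hx => by
  rw [bilin_smul]
  exact mul_neg_of_pos_of_neg (by positivity) (hτ x hx)

theorem mul_bilin_pos {x : V} (hx : 0 < P.discr x) {t : Fin 2 → ℝ} (ht : t ≠ 0) :
    0 < P.B₁ x x * P.bilin t x x := by
  have hsq : P.B₁ x x * P.bilin t x x =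
      (P.B₁ x x * t 0 + P.B₂ x x * t 1) ^ 2 + P.discr x * t 1 ^ 2 := by
    rw [bilin_apply, discr]
    ring
  rw [hsq]
  rcases eq_or_ne (t 1) 0 with h1 | h1
  · have h0 : t 0 ≠ 0 := fun h0 => ht (by ext i; fin_cases i <;> assumption)
    have hB₁ : P.B₁ x x ≠ 0 := by
      rintro hB
      rw [discr, hB] at hx
      nlinarith [sq_nonneg (P.B₂ x x)]
    rw [h1, mul_zero, add_zero, zero_pow two_ne_zero, mul_zero, add_zero]
    positivity
  · positivity

theorem mem_base_of_discr_nonpos {x : V} (hx : P.discr x ≤ 0) : x ∈ P.base := by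
  rcases le_or_gt 0 (P.B₁ x x) with h | h
  · exact ⟨![1, 0], fun e => one_ne_zero (congrFun e 0), by simpa [bilin_apply] using h⟩
  · refine ⟨![-P.B₂ x x, P.B₁ x x], fun e => h.ne (congrFun e 1), ?_⟩
    have hval : P.bilin ![-P.B₂ x x, P.B₁ x x] x x = P.B₁ x x * P.discr x := by
      simp only [bilin_apply, discr, Matrix.cons_val_zero, Matrix.cons_val_one]
      ring
    rw [hval]
    exact mul_nonneg_of_nonpos_of_nonpos h.le hx

theorem NegDef.base_eq (hτ : P.NegDef τ) : P.base = {x | P.discr x ≤ 0} := by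
  refine Subset.antisymm ?_ fun x hx => mem_base_of_discr_nonpos hx
  rintro x ⟨t, ht0, ht⟩
  by_contra hx'
  have hx : 0 < P.discr x := not_le.mp hx'
  have hx0 : x ≠ 0 := by
    rintro rfl
    exact hx.ne' P.discr_zero
  have hτx := hτ x hx0
  have hτ0 : τ ≠ 0 := by
    rintro rfl
    simp [bilin_apply] at hτx
  have hB₁ : P.B₁ x x < 0 := neg_of_mul_pos_left (mul_bilin_pos hx hτ0) hτx.le
  exact (mul_bilin_pos hx ht0).not_ge (mul_nonpos_of_nonpos_of_nonneg hB₁.le ht)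

end Base

section Components

variable {V : Type*} [NormedAddCommGroup V] [NormedSpace ℝ V] [FiniteDimensional ℝ V]
  {P : QuadricFamily V} {B C C' : Set V}

theorem isClosed_setOf_bilin_nonneg (P : QuadricFamily V) (hC : IsProjCone C) :
    IsClosed {t | ∃ x ∈ C, x ≠ 0 ∧ 0 ≤ P.bilin t x x} := by
  have : ProperSpace V := FiniteDimensional.proper ℝ V
  have hK : IsCompact (C ∩ Metric.sphere (0 : V) 1) :=
    (isCompact_sphere 0 1).inter_left hC.isClosed
  have : CompactSpace ↥(C ∩ Metric.sphere (0 : V) 1) := isCompact_iff_compactSpace.mp hK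
  have hcont : Continuous fun p : (Fin 2 → ℝ) × ↥(C ∩ Metric.sphere (0 : V) 1) =>
      P.bilin p.1 p.2 p.2 := by fun_prop
  have hclosed := isClosed_le (continuous_const (y := (0 : ℝ))) hcont
  convert isClosedMap_fst_of_compactSpace _ hclosed using 1
  ext t
  constructor
  · rintro ⟨x, hxC, hx0, hx⟩
    refine ⟨(t, ⟨‖x‖⁻¹ • x, hC.smul_mem _ x hxC, by simp [norm_smul, hx0]⟩), ?_, rfl⟩
    simp only [mem_ofPred_eq, map_smul, LinearMap.smul_apply, smul_eq_mul]
    positivity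
  · rintro ⟨⟨t', x, hxC, hx1⟩, hx, rfl⟩
    exact ⟨x, hxC, ne_zero_of_mem_unit_sphere ⟨x, hx1⟩, hx⟩

theorem isOpen_negDef (P : QuadricFamily V) : IsOpen {t | P.NegDef t} := by
  convert (P.isClosed_setOf_bilin_nonneg isProjCone_univ).isOpen_compl using 1
  ext t
  simp [NegDef]

/- Otherwise the parameters of the forms that are nonnegative somewhere on `C` and those of the
forms that are nonnegative somewhere on `C'` would be two closed sets covering `S`. -/
theorem exists_negDef_mem (h : ConeSplit P.base C C') {S : Set (Fin 2 → ℝ)}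
    (hS : IsPreconnected S) (hS0 : (0 : Fin 2 → ℝ) ∉ S)
    (hC : ∃ t ∈ S, ∃ x ∈ C, x ≠ 0 ∧ 0 ≤ P.bilin t x x)
    (hC' : ∃ t ∈ S, ∃ x ∈ C', x ≠ 0 ∧ 0 ≤ P.bilin t x x) : ∃ τ ∈ S, P.NegDef τ := by
  by_contra! hS_neg
  have hbase {t} (ht : t ∈ S) : {x | 0 ≤ P.bilin t x x} ⊆ P.base :=
    fun x hx => ⟨t, ne_of_mem_of_not_mem ht hS0, hx⟩
  have hcover : S ⊆ {t | ∃ x ∈ C, x ≠ 0 ∧ 0 ≤ P.bilin t x x} ∪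
      {t | ∃ x ∈ C', x ≠ 0 ∧ 0 ≤ P.bilin t x x} := by
    intro t ht
    have hneg := hS_neg t ht
    simp only [NegDef, not_forall, not_lt] at hneg
    obtain ⟨x, hx0, hx⟩ := hneg
    exact (h.mem_or_mem (hbase ht hx)).imp (fun hxC => ⟨x, hxC, hx0, hx⟩)
      fun hxC => ⟨x, hxC, hx0, hx⟩
  obtain ⟨t, ht, ⟨x, hxC, hx0, hx⟩, y, hyC, hy0, hy⟩ := isPreconnected_closed_iff.mp hS _ _
    (P.isClosed_setOf_bilin_nonneg h.left) (P.isClosed_setOf_bilin_nonneg h.right) hcover hC hC'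
  exact (h.bilinForm_neg (P.isSymm_bilin t) (hbase ht) hxC hx0 hx hyC hy0).not_ge hy

theorem exists_negDef (h : ConeSplit P.base C C') (hC : ∃ x ∈ C, x ≠ 0) (hC' : ∃ x ∈ C', x ≠ 0) :
    ∃ τ, P.NegDef τ := by
  obtain ⟨x, hx, hx0⟩ := hC
  obtain ⟨x', hx', hx0'⟩ := hC'
  obtain ⟨t, ht0, ht⟩ := h.subset_left hx
  obtain ⟨t', ht0', ht'⟩ := h.subset_right hx'
  have hconn : IsPreconnected ({0}ᶜ : Set (Fin 2 → ℝ)) :=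
    (isConnected_compl_singleton_of_one_lt_rank (by simp) 0).isPreconnected
  obtain ⟨τ, -, hτ⟩ := exists_negDef_mem h hconn (notMem_compl_iff.mpr rfl)
    ⟨t, ht0, x, hx, hx0, ht⟩ ⟨t', ht0', x', hx', hx0', ht'⟩
  exact ⟨τ, hτ⟩

theorem Smooth.exists_discr_neg (hP : P.Smooth) (h : ConeSplit {x | P.discr x ≤ 0} C C')
    (hC : ∃ x ∈ C, x ≠ 0) : ∃ x ∈ C, P.discr x < 0 := by
  obtain ⟨x, hxC, hx0⟩ := hC
  have hx_nonpos : P.discr x ≤ 0 := h.subset_left hxC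
  rcases hx_nonpos.lt_or_eq with hx | hx
  · exact ⟨x, hxC, hx⟩
  obtain ⟨v, hv⟩ : ∃ v, P.discrDeriv x v < 0 := by
    obtain ⟨v, hv⟩ := hP x hx0 hx
    exact ⟨-P.discrDeriv x v • v, by rw [discrDeriv_smul]; nlinarith [mul_self_pos.mpr hv]⟩
  have hslope : ∀ᶠ s : ℝ in 𝓝 0, P.slope x v s < 0 := by
    have hcont : Continuous (P.slope x v) := by fun_prop
    exact hcont.continuousAt.eventually_lt_const (by rw [slope_zero]; linarith)
  have hmem : ∀ᶠ s : ℝ in 𝓝 0, x + s • v ∉ C' := by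
    have hcont : Continuous fun s : ℝ => x + s • v := by fun_prop
    refine hcont.continuousAt.eventually_mem (h.right.isClosed.isOpen_compl.mem_nhds ?_)
    simpa using fun hxC' => hx0 (h.eq_zero x hxC hxC')
  obtain ⟨s, ⟨hs, hsC'⟩, hs0 : 0 < s⟩ := (((hslope.and hmem).filter_mono
    (nhdsWithin_le_nhds (s := Ioi 0))).and self_mem_nhdsWithin).exists
  have hneg : P.discr (x + s • v) < 0 := by
    rw [discr_add_smul, hx, zero_add]
    exact mul_neg_of_pos_of_neg hs0 hs
  exact ⟨x + s • v, (h.mem_or_mem hneg.le).resolve_right hsC', hneg⟩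

end Components

end QuadricFamily

section Frontier

variable {α : Type*} [ConditionallyCompleteLinearOrder α] [DenselyOrdered α] [TopologicalSpace α]
  [OrderTopology α] {G : Set α} {a : α}

theorem exists_frontier_gt (hG : IsOpen G) (hub : ¬BddAbove G) (ha : a ∉ closure G) :
    ∃ c ∈ frontier G, a < c ∧ ∀ y, a ≤ y → y ≤ c → y ∉ G := by
  obtain ⟨g, hg, hag⟩ := not_bddAbove_iff.mp hub a
  have hne : (G ∩ Ioi a).Nonempty := ⟨g, hg, hag⟩
  have hbdd : BddBelow (G ∩ Ioi a) := ⟨a, fun y hy => le_of_lt hy.2⟩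
  have hc : sInf (G ∩ Ioi a) ∈ closure G :=
    closure_mono inter_subset_left (csInf_mem_closure hne hbdd)
  have hac : a < sInf (G ∩ Ioi a) :=
    (le_csInf hne fun y hy => le_of_lt hy.2).lt_of_ne (ne_of_mem_of_not_mem hc ha).symm
  have hlt : ∀ y, a ≤ y → y < sInf (G ∩ Ioi a) → y ∉ G := fun y hay hy hyG =>
    notMem_of_lt_csInf hy hbdd
      ⟨hyG, hay.lt_of_ne (ne_of_mem_of_not_mem (subset_closure hyG) ha).symm⟩
  have hcG : sInf (G ∩ Ioi a) ∉ G := by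
    intro hcG
    obtain ⟨l, ⟨hal, hlc⟩, hl⟩ := exists_Ioc_subset_of_mem_nhds' (hG.mem_nhds hcG) hac
    obtain ⟨y, hly, hyc⟩ := exists_between hlc
    exact hlt y (hal.trans hly.le) hyc (hl ⟨hly, hyc.le⟩)
  refine ⟨_, ⟨hc, hG.interior_eq.symm ▸ hcG⟩, hac, fun y hay hyc => ?_⟩
  rcases hyc.lt_or_eq with hyc | rfl
  exacts [hlt y hay hyc, hcG]

theorem exists_frontier_lt (hG : IsOpen G) (hlb : ¬BddBelow G) (ha : a ∉ closure G) :
    ∃ c ∈ frontier G, c < a ∧ ∀ y, c ≤ y → y ≤ a → y ∉ G := by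
  obtain ⟨c, hc, hca, h⟩ := exists_frontier_gt (α := αᵒᵈ) hG hlb ha
  exact ⟨c, hc, hca, fun y hcy hya => h y hya hcy⟩

theorem exists_injective_sum_frontier {ι : Type*} (hG : IsOpen G) (hlb : ¬BddBelow G)
    (hub : ¬BddAbove G) {s : ι → α} (hs : ∀ i, s i ∉ closure G)
    (hsep : ∀ i j, i ≠ j → ∃ g ∈ uIcc (s i) (s j), g ∈ G) :
    ∃ f : ι ⊕ ι → α, f.Injective ∧ ∀ k, f k ∈ frontier G := by
  choose f hf hsf hGf using fun i => exists_frontier_lt hG hlb (hs i)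
  choose f' hf' hsf' hGf' using fun i => exists_frontier_gt hG hub (hs i)
  have hne {i j : ι} {c : α} (hi : ∀ y ∈ uIcc (s i) c, y ∉ G) (hj : ∀ y ∈ uIcc c (s j), y ∉ G) :
      i = j := by
    by_contra hij
    obtain ⟨g, hg, hgG⟩ := hsep i j hij
    exact (uIcc_subset_uIcc_union_uIcc hg).elim (hi g · hgG) (hj g · hgG)
  have hleft i : ∀ y ∈ uIcc (f i) (s i), y ∉ G := fun y hy => by
    rw [uIcc_of_le (hsf i).le] at hy
    exact hGf i y hy.1 hy.2
  have hright i : ∀ y ∈ uIcc (s i) (f' i), y ∉ G := fun y hy => by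
    rw [uIcc_of_le (hsf' i).le] at hy
    exact hGf' i y hy.1 hy.2
  have hff' {i j : ι} (h : f i = f' j) : False := by
    obtain rfl : j = i := hne (hright j) (h ▸ hleft i)
    exact ((hsf j).trans (hsf' j)).ne h
  refine ⟨Sum.elim f f', ?_, Sum.rec hf hf'⟩
  rintro (i | i) (j | j) hij
  · have hij : f i = f j := hij
    exact congrArg Sum.inl (hne (uIcc_comm (f i) (s i) ▸ hleft i) (hij ▸ hleft j))
  · exact (hff' hij).elim
  · exact (hff' hij.symm).elim
  · have hij : f' i = f' j := hij
    exact congrArg Sum.inr (hne (hright i) (hij ▸ uIcc_comm (s j) (f' j) ▸ hright j))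

end Frontier

section Polynomials

open Polynomial

theorem natDegree_det_le {n R : Type*} [Fintype n] [DecidableEq n] [CommRing R] {d : ℕ}
    {M : Matrix n n R[X]} (hM : ∀ i j, (M i j).natDegree ≤ d) :
    M.det.natDegree ≤ Fintype.card n * d := by
  rw [Matrix.det_apply]
  refine natDegree_sum_le_of_forall_le _ _ fun π _ => (natDegree_smul_le _ _).trans ?_
  calc (∏ i, M (π i) i).natDegree ≤ ∑ i, (M (π i) i).natDegree := natDegree_prod_le _ _
    _ ≤ ∑ _ : n, d := Finset.sum_le_sum fun i _ => hM (π i) i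
    _ = Fintype.card n * d := by simp

end Polynomials

namespace QuadricFamily

section ParameterLine

variable {ι V : Type*} [AddCommGroup V] [Module ℝ V] {P : QuadricFamily V} {σ τ : Fin 2 → ℝ}

open Polynomial in
theorem exists_det_polynomial [Fintype ι] [DecidableEq ι] (P : QuadricFamily V)
    (b : Module.Basis ι ℝ V) (σ τ : Fin 2 → ℝ) : ∃ p : ℝ[X], p.natDegree ≤ Fintype.card ι * 2 ∧
      ∀ s, p.eval s = (LinearMap.BilinForm.toMatrix b (P.bilin (σ + s • τ))).det := by
  let M : Matrix ι ι ℝ[X] := Matrix.of fun i j =>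
    (C (σ 0) + X * C (τ 0)) ^ 2 * C (P.B₁ (b i) (b j))
      + 2 * (C (σ 0) + X * C (τ 0)) * (C (σ 1) + X * C (τ 1)) * C (P.B₂ (b i) (b j))
      + (C (σ 1) + X * C (τ 1)) ^ 2 * C (P.B₃ (b i) (b j))
  refine ⟨M.det, natDegree_det_le fun i j => ?_, fun s => ?_⟩
  · simp only [M, Matrix.of_apply]
    compute_degree
  · rw [← coe_evalRingHom, RingHom.map_det, RingHom.mapMatrix_apply]
    congr 1
    ext i j
    simp only [M, Matrix.map_apply, Matrix.of_apply, LinearMap.BilinForm.toMatrix_apply,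
      bilin_apply, coe_evalRingHom, eval_add, eval_mul, eval_pow, eval_C, eval_X, eval_ofNat,
      Pi.add_apply, Pi.smul_apply, smul_eq_mul]

theorem NegDef.nondegenerate (hτ : P.NegDef τ) : (P.bilin τ).Nondegenerate := by
  refine (P.isSymm_bilin τ).isRefl.nondegenerate_iff_separatingLeft.mpr fun x hx => ?_
  by_contra hx0
  exact (hτ x hx0).ne (hx x)

theorem NegDef.exists_independent (hτ : P.NegDef τ) {x : V} (hx : x ≠ 0) :
    ∃ σ : Fin 2 → ℝ, σ 0 * τ 1 - σ 1 * τ 0 ≠ 0 := by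
  by_contra! hdet
  have h1 : τ 1 = 0 := by simpa using hdet ![1, 0]
  have h0 : τ 0 = 0 := by simpa using hdet ![0, 1]
  have hx_neg := hτ x hx
  simp [bilin_apply, h0, h1] at hx_neg

theorem zero_notMem_image_line (hστ : σ 0 * τ 1 - σ 1 * τ 0 ≠ 0) (S : Set ℝ) :
    (0 : Fin 2 → ℝ) ∉ (fun s : ℝ => σ + s • τ) '' S := by
  rintro ⟨s, -, hs⟩
  have h0 : σ 0 + s * τ 0 = 0 := congrFun hs 0
  have h1 : σ 1 + s * τ 1 = 0 := congrFun hs 1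
  exact hστ (by linear_combination τ 1 * h0 - τ 0 * h1)

/- Completing the square in `s`, whose leading coefficient `q_τ(x)` is negative. -/
theorem NegDef.exists_bilin_pos (hτ : P.NegDef τ) (hστ : σ 0 * τ 1 - σ 1 * τ 0 ≠ 0) {x : V}
    (hx : P.discr x < 0) : ∃ s : ℝ, 0 < P.bilin (σ + s • τ) x x := by
  have hx0 : x ≠ 0 := by
    rintro rfl
    exact hx.ne P.discr_zero
  have hneg := hτ x hx0
  set b := σ 0 * τ 0 * P.B₁ x x + (σ 0 * τ 1 + σ 1 * τ 0) * P.B₂ x x + σ 1 * τ 1 * P.B₃ x x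
    with hb
  have hquad (s : ℝ) :
      P.bilin (σ + s • τ) x x = P.bilin σ x x + 2 * s * b + s ^ 2 * P.bilin τ x x := by
    simp only [bilin_apply, hb, Pi.add_apply, Pi.smul_apply, smul_eq_mul]
    ring
  have hdisc : P.bilin σ x x * P.bilin τ x x - b ^ 2 =
      P.discr x * (σ 0 * τ 1 - σ 1 * τ 0) ^ 2 := by
    simp only [bilin_apply, discr, hb]
    ring
  refine ⟨-b / P.bilin τ x x, ?_⟩
  calc 0 < P.discr x * (σ 0 * τ 1 - σ 1 * τ 0) ^ 2 / P.bilin τ x x :=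
        div_pos_of_neg_of_neg (mul_neg_of_neg_of_pos hx (by positivity)) hneg
    _ = P.bilin (σ + (-b / P.bilin τ x x) • τ) x x := by
        rw [← hdisc, hquad]
        field_simp [hneg.ne]
        ring

end ParameterLine

section ComponentCount

variable {ι V : Type*} [NormedAddCommGroup V] [NormedSpace ℝ V] [FiniteDimensional ℝ V]
  {P : QuadricFamily V} {σ τ : Fin 2 → ℝ}

theorem not_nondegenerate_of_mem_frontier {t : Fin 2 → ℝ} (ht : t ∈ frontier {t | P.NegDef t}) :
    ¬(P.bilin t).Nondegenerate := by
  have hnonpos : ∀ x, P.bilin t x x ≤ 0 := by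
    intro x
    rcases eq_or_ne x 0 with rfl | hx
    · simp
    have hclosed : IsClosed {t | P.bilin t x x ≤ 0} := isClosed_le (by fun_prop) continuous_const
    exact closure_minimal (fun t (ht : P.NegDef t) => (ht x hx).le) hclosed ht.1
  obtain ⟨x, hx0, hx⟩ : ∃ x, x ≠ 0 ∧ 0 ≤ P.bilin t x x := by
    have ht_not : ¬P.NegDef t := fun h => ht.2 (P.isOpen_negDef.interior_eq.symm ▸ h)
    simpa only [NegDef, not_forall, not_lt, exists_prop] using ht_not
  have hker : x ∈ LinearMap.ker (-P.bilin t) :=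
    ((-P.bilin t).apply_apply_same_eq_zero_iff (fun y => neg_nonneg.mpr (hnonpos y))
      ⟨fun y z => congrArg Neg.neg ((P.isSymm_bilin t).eq y z)⟩).mp
      (neg_eq_zero.mpr ((hnonpos x).antisymm hx))
  exact fun hnd => hx0 (hnd.1 x fun y => neg_eq_zero.mp (LinearMap.congr_fun hker y))

theorem NegDef.not_bddAbove_line_and_not_bddBelow_line (hτ : P.NegDef τ) (σ : Fin 2 → ℝ) :
    ¬BddAbove {s : ℝ | P.NegDef (σ + s • τ)} ∧ ¬BddBelow {s : ℝ | P.NegDef (σ + s • τ)} := by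
  have hnear : ∀ᶠ r : ℝ in 𝓝 0, P.NegDef (τ + r • σ) := by
    have hcont : Continuous fun r : ℝ => τ + r • σ := by fun_prop
    exact hcont.continuousAt.eventually_mem (P.isOpen_negDef.mem_nhds (by simpa using hτ))
  have hfar : ∀ᶠ s : ℝ in Bornology.cobounded ℝ, P.NegDef (σ + s • τ) := by
    filter_upwards [tendsto_inv₀_cobounded.eventually hnear, Bornology.eventually_ne_cobounded 0]
      with s hs hs0
    rw [show σ + s • τ = s • (τ + s⁻¹ • σ) by rw [smul_add, smul_inv_smul₀ hs0, add_comm]]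
    exact hs.smul hs0
  rw [IsOrderBornology.cobounded_eq, eventually_sup] at hfar
  refine ⟨not_bddAbove_iff.mpr fun a => ?_, not_bddBelow_iff.mpr fun a => ?_⟩
  · exact (hfar.2.and (eventually_gt_atTop a)).exists
  · exact (hfar.1.and (eventually_lt_atBot a)).exists

/- Each component contributes an interval of forms that are positive somewhere on it, and these
intervals are separated by negative definite forms. -/
theorem Smooth.exists_injective_sum_frontier [Finite ι] (hP : P.Smooth) {C : ι → Set V}
    (h : ConePartition P.base C) (hτ : P.NegDef τ) (hστ : σ 0 * τ 1 - σ 1 * τ 0 ≠ 0) :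
    ∃ f : ι ⊕ ι → ℝ, f.Injective ∧ ∀ k, f k ∈ frontier {s : ℝ | P.NegDef (σ + s • τ)} := by
  have hγ : Continuous fun s : ℝ => σ + s • τ := by fun_prop
  choose x hx hx_neg using fun i =>
    hP.exists_discr_neg (hτ.base_eq ▸ h.split_singleton i) (h.nontrivial i)
  have hx_ne i : x i ≠ 0 := fun e => (hx_neg i).ne (e ▸ P.discr_zero)
  choose s hs using fun i => hτ.exists_bilin_pos hστ (hx_neg i)
  have hs_notMem i : s i ∉ closure {s : ℝ | P.NegDef (σ + s • τ)} := by
    have hclosed : IsClosed {r : ℝ | P.bilin (σ + r • τ) (x i) (x i) ≤ 0} :=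
      isClosed_le (by fun_prop) continuous_const
    exact fun hi => (hs i).not_ge
      (closure_minimal (fun r (hr : P.NegDef (σ + r • τ)) => (hr _ (hx_ne i)).le) hclosed hi)
  have hsep i j (hij : i ≠ j) :
      ∃ g ∈ uIcc (s i) (s j), g ∈ {s : ℝ | P.NegDef (σ + s • τ)} := by
    obtain ⟨_, ⟨g, hg, rfl⟩, hg_neg⟩ := exists_negDef_mem (h.split_singleton i)
      (isPreconnected_uIcc.image _ hγ.continuousOn) (zero_notMem_image_line hστ _)
      ⟨_, mem_image_of_mem _ left_mem_uIcc, x i, hx i, hx_ne i, (hs i).le⟩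
      ⟨_, mem_image_of_mem _ right_mem_uIcc, x j, mem_biUnion_compl_singleton hij (hx j),
        hx_ne j, (hs j).le⟩
    exact ⟨g, hg, hg_neg⟩
  obtain ⟨hub, hlb⟩ := hτ.not_bddAbove_line_and_not_bddBelow_line σ
  exact _root_.exists_injective_sum_frontier (P.isOpen_negDef.preimage hγ) hlb hub hs_notMem hsep

/- The determinant, of degree `2 dim V` along a line of parameters in a negative definite direction,
vanishes at the `2 card ι` frontier points found above. -/
theorem Smooth.card_le_finrank [Fintype ι] [Nontrivial ι] (hP : P.Smooth) {C : ι → Set V}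
    (h : ConePartition P.base C) : Fintype.card ι ≤ Module.finrank ℝ V := by
  obtain ⟨i, j, hij⟩ := exists_pair_ne ι
  obtain ⟨x, hx, hx0⟩ := h.nontrivial j
  obtain ⟨τ, hτ⟩ := exists_negDef (h.split_singleton i) (h.nontrivial i)
    ⟨x, mem_biUnion_compl_singleton hij hx, hx0⟩
  obtain ⟨σ, hστ⟩ := hτ.exists_independent hx0
  have hγ : Continuous fun s : ℝ => σ + s • τ := by fun_prop
  obtain ⟨f, hf, hf_mem⟩ := hP.exists_injective_sum_frontier h hτ hστ
  let b := Module.finBasis ℝ V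
  obtain ⟨p, hp_deg, hp⟩ := P.exists_det_polynomial b σ τ
  by_contra! hcard
  have hp_zero : p = 0 := by
    refine p.eq_zero_of_natDegree_lt_card_of_eval_eq_zero hf (fun k => ?_) ?_
    · have hk := not_nondegenerate_of_mem_frontier (hγ.frontier_preimage_subset _ (hf_mem k))
      rwa [LinearMap.BilinForm.nondegenerate_iff_det_ne_zero b, ne_eq, not_not, ← hp] at hk
    · rw [Fintype.card_fin] at hp_deg
      rw [Fintype.card_sum]
      lia
  obtain ⟨s, hs : P.NegDef (σ + s • τ), -⟩ :=
    not_bddAbove_iff.mp (hτ.not_bddAbove_line_and_not_bddBelow_line σ).1 0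
  refine (LinearMap.BilinForm.nondegenerate_iff_det_ne_zero b).mp hs.nondegenerate ?_
  rw [← hp, hp_zero, Polynomial.eval_zero]

end ComponentCount

end QuadricFamily

theorem eval_eq_coeff_mul_prod {R : Type*} [CommRing R] [IsDomain R] {n : ℕ} {p : Polynomial R}
    (hp : p.natDegree ≤ n) {r : Fin n → R} (hr : Function.Injective r)
    (h0 : ∀ i, p.eval (r i) = 0) (x : R) : p.eval x = p.coeff n * ∏ i, (x - r i) := by
  have hmonic : (Lagrange.nodal Finset.univ r).Monic := Lagrange.nodal_monic
  have hdeg : (Lagrange.nodal Finset.univ r).natDegree = n := by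
    rw [Lagrange.natDegree_nodal, Finset.card_fin]
  have hlt : (p - Polynomial.C (p.coeff n) * Lagrange.nodal Finset.univ r).degree < n := by
    rw [Polynomial.degree_lt_iff_coeff_zero]
    intro m hm
    rw [Polynomial.coeff_sub, Polynomial.coeff_C_mul]
    rcases hm.eq_or_lt with rfl | hm
    · rw [show (Lagrange.nodal Finset.univ r).coeff n = 1 by
          simpa only [hdeg] using hmonic.coeff_natDegree, mul_one, sub_self]
    · rw [Polynomial.coeff_eq_zero_of_natDegree_lt (hp.trans_lt hm),
        Polynomial.coeff_eq_zero_of_natDegree_lt (hdeg.trans_lt hm), mul_zero, sub_zero]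
  have heq : p = Polynomial.C (p.coeff n) * Lagrange.nodal Finset.univ r := by
    refine Polynomial.eq_of_degree_sub_lt_of_eval_index_eq Finset.univ (v := r) hr.injOn
      (by rwa [Finset.card_fin]) fun i hi => ?_
    rw [h0, Polynomial.eval_mul, Lagrange.eval_nodal_at_node hi, mul_zero]
  conv_lhs => rw [heq]
  rw [Polynomial.eval_mul, Polynomial.eval_C, Lagrange.eval_nodal]

theorem QuadricFamily.exists_discr_line_polynomial {V : Type*} [AddCommGroup V] [Module ℝ V]
    (P : QuadricFamily V) (y e : V) : ∃ p : Polynomial ℝ, p.natDegree ≤ 4 ∧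
      p.coeff 4 = P.discr e ∧ ∀ r, p.eval r = P.discr (y + r • e) := by
  open Polynomial in
  refine ⟨C (P.discr y) + C (2 * P.discrDeriv y e) * X
    + C (P.B₁ y y * P.B₃ e e + P.B₁ e e * P.B₃ y y + 4 * P.B₁ y e * P.B₃ y e
        - 4 * P.B₂ y e ^ 2 - 2 * P.B₂ y y * P.B₂ e e) * X ^ 2
    + C (2 * P.discrDeriv e y) * X ^ 3 + C (P.discr e) * X ^ 4, by compute_degree, ?_, fun r => ?_⟩
  · compute_degree!
  · rw [P.discr_add_smul, slope]
    simp only [Polynomial.eval_add, Polynomial.eval_mul, Polynomial.eval_C, Polynomial.eval_X,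
      Polynomial.eval_pow]
    ring

section Slices

variable {V : Type*} [AddCommGroup V] [Module ℝ V]

/-- The parameters of the points of the line `y + ℝ e` that lie in `C`. -/
def slice (C : Set V) (e y : V) : Set ℝ := {r | y + r • e ∈ C}

/-- The lower end of a slice, `0` if the slice is empty or unbounded below. -/
noncomputable def lo (C : Set V) (e y : V) : ℝ := sInf (slice C e y)

/-- The upper end of a slice, `0` if the slice is empty or unbounded above. -/
noncomputable def hi (C : Set V) (e y : V) : ℝ := sSup (slice C e y)

/-- The points `y` such that the line `y + ℝ e` avoids the origin and meets `C`: for a cone `C`,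
the shadow of its projectivization under the projection from the point `[e]`. -/
def shadow (C : Set V) (e : V) : Set V := {y | (slice C e y).Nonempty ∧ ∀ r : ℝ, y + r • e ≠ 0}

theorem slice_neg (C : Set V) (e y : V) : slice C (-e) y = -slice C e y := by
  ext r
  simp only [slice, Set.mem_neg, mem_ofPred_eq, smul_neg, neg_smul]

theorem lo_neg (C : Set V) (e y : V) : lo C (-e) y = -hi C e y := by
  rw [lo, slice_neg, Real.sInf_neg, hi]

theorem shadow_neg (C : Set V) (e : V) : shadow C (-e) = shadow C e := by
  ext y
  refine and_congr (by rw [slice_neg, Set.nonempty_neg]) ?_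
  rw [(neg_surjective (G := ℝ)).forall]
  simp only [neg_smul_neg]

end Slices

/-- The set `{discr ≤ 0}` splits into two cones, and `e` is an interior point of the second one from
which the first one is viewed. -/
structure QuadricFamily.IsViewpoint {V : Type*} [AddCommGroup V] [Module ℝ V] [TopologicalSpace V]
    (P : QuadricFamily V) (C C' : Set V) (e : V) : Prop
    extends ConeSplit {x | P.discr x ≤ 0} C C' where
  mem_right : e ∈ C'
  discr_neg : P.discr e < 0

namespace QuadricFamily

variable {V : Type*} [NormedAddCommGroup V] [NormedSpace ℝ V] {P : QuadricFamily V}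

theorem hasDerivAt_discr_line (y e : V) (r : ℝ) :
    HasDerivAt (fun r => P.discr (y + r • e)) (2 * P.discrDeriv (y + r • e) e) r := by
  have hslope : DifferentiableAt ℝ (P.slope (y + r • e) e) (r - r) := by
    unfold slope
    fun_prop
  have hderiv := (((hasDerivAt_id' (r - r)).mul hslope.hasDerivAt).const_add
    (P.discr (y + r • e))).comp_sub_const r r
  simp only [Pi.mul_apply, ← P.discr_add_smul, sub_self, P.slope_zero, one_mul, zero_mul,
    add_zero, add_assoc, ← add_smul, add_sub_cancel] at hderiv
  exact hderiv

namespace IsViewpoint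

variable {C C' : Set V} {e y : V} {r : ℝ}

theorem neg (h : P.IsViewpoint C C' e) : P.IsViewpoint C C' (-e) where
  toConeSplit := h.toConeSplit
  mem_right := by simpa only [neg_one_smul] using h.right.smul_mem (-1) e h.mem_right
  discr_neg := by
    rw [← neg_one_smul ℝ, P.discr_smul]
    linarith [h.discr_neg]

theorem ne_zero (h : P.IsViewpoint C C' e) : e ≠ 0 := by
  rintro rfl
  exact h.discr_neg.ne P.discr_zero

theorem notMem_left (h : P.IsViewpoint C C' e) : e ∉ C :=
  fun he => h.ne_zero (h.eq_zero e he h.mem_right)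

theorem exists_slice_bound (h : P.IsViewpoint C C' e) :
    ∃ M : ℝ, 0 ≤ M ∧ ∀ y, ∀ r ∈ slice C e y, |r| ≤ M * ‖y‖ := by
  obtain ⟨δ, hδ, hball⟩ := Metric.isOpen_iff.mp h.left.isClosed.isOpen_compl e h.notMem_left
  refine ⟨δ⁻¹, by positivity, fun y r hr => ?_⟩
  rcases eq_or_ne r 0 with rfl | hr0
  · simp only [abs_zero]
    positivity
  have hmem : e + r⁻¹ • y ∈ C := by
    have := h.left.smul_mem r⁻¹ _ hr
    rwa [smul_add, inv_smul_smul₀ hr0, add_comm] at this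
  have hd : δ ≤ ‖r⁻¹ • y‖ := by
    by_contra! hlt
    exact hball (by simpa using hlt) hmem
  rw [norm_smul, norm_inv, Real.norm_eq_abs, inv_mul_eq_div, le_div_iff₀ (abs_pos.mpr hr0)] at hd
  rwa [inv_mul_eq_div, le_div_iff₀' hδ]

theorem isCompact_slice (h : P.IsViewpoint C C' e) (y : V) : IsCompact (slice C e y) := by
  obtain ⟨M, -, hM⟩ := h.exists_slice_bound
  refine isCompact_Icc.of_isClosed_subset ?_ fun r hr => abs_le.mp (hM y r hr)
  exact h.left.isClosed.preimage (by fun_prop : Continuous fun r : ℝ => y + r • e)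

theorem lo_mem (h : P.IsViewpoint C C' e) (hy : y ∈ shadow C e) : lo C e y ∈ slice C e y :=
  (h.isCompact_slice y).sInf_mem hy.1

theorem lo_le (h : P.IsViewpoint C C' e) (hr : r ∈ slice C e y) : lo C e y ≤ r :=
  csInf_le (h.isCompact_slice y).bddBelow hr

theorem hi_mem (h : P.IsViewpoint C C' e) (hy : y ∈ shadow C e) : hi C e y ∈ slice C e y :=
  (h.isCompact_slice y).sSup_mem hy.1

theorem le_hi (h : P.IsViewpoint C C' e) (hr : r ∈ slice C e y) : r ≤ hi C e y :=
  le_csSup (h.isCompact_slice y).bddAbove hr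

theorem lo_le_hi (h : P.IsViewpoint C C' e) (hy : y ∈ shadow C e) : lo C e y ≤ hi C e y :=
  h.lo_le (h.hi_mem hy)

theorem eventually_discr_pos (h : P.IsViewpoint C C' e) (hr : r ∈ slice C e y)
    (h0 : y + r • e ≠ 0) : ∀ᶠ s in 𝓝 r, s ∉ slice C e y → 0 < P.discr (y + s • e) := by
  have hc : Continuous fun s : ℝ => y + s • e := by fun_prop
  filter_upwards [(hc.tendsto r).eventually_mem (h.right.isClosed.isOpen_compl.mem_nhds
    fun hr' => h0 (h.eq_zero _ hr hr'))] with s hs hs'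
  by_contra! hneg
  exact (h.mem_or_mem hneg).elim hs' hs

theorem eventually_discr_pos_left (h : P.IsViewpoint C C' e) (hy : y ∈ shadow C e) :
    ∀ᶠ r in 𝓝[<] (lo C e y), 0 < P.discr (y + r • e) := by
  filter_upwards [(h.eventually_discr_pos (h.lo_mem hy) (hy.2 _)).filter_mono nhdsWithin_le_nhds,
    self_mem_nhdsWithin] with r hr hlt
  exact hr fun hmem => (h.lo_le hmem).not_gt hlt

theorem eventually_forall_mem_slice {X : Type*} [TopologicalSpace X] (h : P.IsViewpoint C C' e)
    {g : X → V} (hg : Continuous g) {x₀ : X} {p : X → ℝ → Prop}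
    (hp : ∀ r ∈ slice C e (g x₀), ∀ᶠ z : X × ℝ in 𝓝 (x₀, r), p z.1 z.2) :
    ∀ᶠ x in 𝓝 x₀, ∀ r ∈ slice C e (g x), p x r := by
  obtain ⟨M, hM, hb⟩ := h.exists_slice_bound
  have hc : Continuous fun z : X × ℝ => g z.1 + z.2 • e := by fun_prop
  have hK : ∀ᶠ x in 𝓝 x₀, ∀ r ∈ Icc (-(M * (‖g x₀‖ + 1))) (M * (‖g x₀‖ + 1)),
      r ∈ slice C e (g x) → p x r := by
    refine isCompact_Icc.eventually_forall_of_forall_eventually fun r _ => ?_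
    by_cases hr : r ∈ slice C e (g x₀)
    · exact (hp r hr).mono fun _ hz _ => hz
    · exact ((hc.tendsto (x₀, r)).eventually_mem (h.left.isClosed.isOpen_compl.mem_nhds hr)).mono
        fun _ hz hz' => absurd hz' hz
  filter_upwards [hK, (hg.norm.tendsto x₀).eventually_lt_const (lt_add_one _)] with x hx hnorm r hr
  exact hx r (abs_le.mp ((hb _ r hr).trans (by gcongr))) hr

variable [FiniteDimensional ℝ V]

theorem discr_lo (h : P.IsViewpoint C C' e) (hy : y ∈ shadow C e) :
    P.discr (y + lo C e y • e) = 0 := by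
  refine le_antisymm (h.subset_left (h.lo_mem hy)) ?_
  have hc : Continuous fun r : ℝ => P.discr (y + r • e) := by fun_prop
  exact ge_of_tendsto hc.continuousWithinAt
    ((h.eventually_discr_pos_left hy).mono fun _ => le_of_lt)

theorem discr_hi (h : P.IsViewpoint C C' e) (hy : y ∈ shadow C e) :
    P.discr (y + hi C e y • e) = 0 := by
  simpa only [lo_neg, smul_neg, neg_smul, neg_neg] using h.neg.discr_lo (shadow_neg C e ▸ hy)

theorem eventually_discr_neg_atBot (h : P.IsViewpoint C C' e) (y : V) :
    ∀ᶠ r : ℝ in atBot, P.discr (y + r • e) < 0 := by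
  have hc : Continuous fun s : ℝ => P.discr (e + s • y) := by fun_prop
  have h0 : P.discr (e + (0 : ℝ) • y) < 0 := by simpa only [zero_smul, add_zero] using h.discr_neg
  filter_upwards [tendsto_inv_atBot_zero.eventually ((hc.tendsto 0).eventually_lt_const h0),
    eventually_ne_atBot 0] with r hr hr0
  rw [show y + r • e = r • (e + r⁻¹ • y) by rw [smul_add, smul_inv_smul₀ hr0, add_comm],
    P.discr_smul]
  exact mul_neg_of_pos_of_neg (by positivity) hr

theorem exists_zero_lt_lo (h : P.IsViewpoint C C' e) (hy : y ∈ shadow C e) :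
    ∃ k < lo C e y, P.discr (y + k • e) = 0 := by
  have hc : Continuous fun r : ℝ => P.discr (y + r • e) := by fun_prop
  obtain ⟨b, hb, hblo⟩ := ((h.eventually_discr_pos_left hy).and self_mem_nhdsWithin).exists
  obtain ⟨a, ha, hab⟩ := ((h.eventually_discr_neg_atBot y).and (eventually_lt_atBot b)).exists
  obtain ⟨k, hk, hk0⟩ := intermediate_value_Icc hab.le hc.continuousOn ⟨ha.le, hb.le⟩
  exact ⟨k, hk.2.trans_lt hblo, hk0⟩

theorem exists_hi_lt_zero (h : P.IsViewpoint C C' e) (hy : y ∈ shadow C e) :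
    ∃ k > hi C e y, P.discr (y + k • e) = 0 := by
  obtain ⟨k, hk, hk0⟩ := h.neg.exists_zero_lt_lo (shadow_neg C e ▸ hy)
  exact ⟨-k, lt_neg.mp (lo_neg C e y ▸ hk), by rwa [neg_smul, ← smul_neg]⟩

/- The ends of the slice and one zero on either side of it are all the zeros of the quartic `discr`
on the line `y + ℝ e`. -/
theorem exists_discr_eq_mul (h : P.IsViewpoint C C' e) (hy : y ∈ shadow C e)
    (hlt : lo C e y < hi C e y) : ∃ k₁ < lo C e y, ∃ k₂ > hi C e y, ∀ r, P.discr (y + r • e) =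
      P.discr e * ((r - k₁) * (r - lo C e y) * (r - hi C e y) * (r - k₂)) := by
  obtain ⟨k₁, hk₁, hz₁⟩ := h.exists_zero_lt_lo hy
  obtain ⟨k₂, hk₂, hz₂⟩ := h.exists_hi_lt_zero hy
  obtain ⟨p, hdeg, hcoeff, heval⟩ := P.exists_discr_line_polynomial y e
  have hmono : StrictMono ![k₁, lo C e y, hi C e y, k₂] := by
    simpa using ⟨hk₁, hlt, hk₂⟩
  have hzero : ∀ i, p.eval (![k₁, lo C e y, hi C e y, k₂] i) = 0 := by
    simp [Fin.forall_fin_succ, heval, hz₁, hz₂, h.discr_lo hy, h.discr_hi hy]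
  refine ⟨k₁, hk₁, k₂, hk₂, fun r => ?_⟩
  have hfactor := eval_eq_coeff_mul_prod hdeg hmono.injective hzero r
  simp only [Fin.prod_univ_four, heval, hcoeff] at hfactor
  exact hfactor

theorem discr_neg_of_mem_Ioo (h : P.IsViewpoint C C' e) (hy : y ∈ shadow C e)
    (hr : r ∈ Ioo (lo C e y) (hi C e y)) : P.discr (y + r • e) < 0 := by
  obtain ⟨k₁, hk₁, k₂, hk₂, hfactor⟩ := h.exists_discr_eq_mul hy (hr.1.trans hr.2)
  rw [hfactor]
  refine mul_neg_of_neg_of_pos h.discr_neg (mul_pos_of_neg_of_neg ?_ (sub_neg.mpr ?_))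
  · exact mul_neg_of_pos_of_neg (mul_pos (sub_pos.mpr (hk₁.trans hr.1)) (sub_pos.mpr hr.1))
      (sub_neg.mpr hr.2)
  · exact hr.2.trans hk₂

theorem slice_eq_Icc (h : P.IsViewpoint C C' e) (hy : y ∈ shadow C e) :
    slice C e y = Icc (lo C e y) (hi C e y) := by
  refine Subset.antisymm (fun r hr => ⟨h.lo_le hr, h.le_hi hr⟩) fun r hr => ?_
  have hsub : (fun r : ℝ => y + r • e) '' Icc (lo C e y) (hi C e y) ⊆ {x | P.discr x ≤ 0} := by
    rintro _ ⟨r, hr, rfl⟩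
    rcases eq_endpoints_or_mem_Ioo_of_mem_Icc hr with rfl | rfl | hr
    · exact (h.discr_lo hy).le
    · exact (h.discr_hi hy).le
    · exact (h.discr_neg_of_mem_Ioo hy hr).le
  have hr' := mem_image_of_mem (fun r : ℝ => y + r • e) hr
  refine (h.mem_or_mem (hsub hr')).resolve_right (h.notMem_right_of_isPreconnected
    (isPreconnected_Icc.image _ (by fun_prop)) hsub ?_
    (mem_image_of_mem _ (left_mem_Icc.mpr (h.lo_le_hi hy))) (h.lo_mem hy) hr')
  rintro ⟨s, -, hs⟩
  exact hy.2 s hs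

theorem discr_eq_zero_iff (h : P.IsViewpoint C C' e) (hy : y ∈ shadow C e)
    (hr : r ∈ slice C e y) : P.discr (y + r • e) = 0 ↔ r = lo C e y ∨ r = hi C e y := by
  constructor
  · intro h0
    rw [h.slice_eq_Icc hy] at hr
    rcases eq_endpoints_or_mem_Ioo_of_mem_Icc hr with rfl | rfl | hr
    · exact .inl rfl
    · exact .inr rfl
    · exact absurd h0 (h.discr_neg_of_mem_Ioo hy hr).ne
  · rintro (rfl | rfl)
    · exact h.discr_lo hy
    · exact h.discr_hi hy

theorem eventually_mem_slice (h : P.IsViewpoint C C' e) (hr : r ∈ slice C e y)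
    (hd : P.discr (y + r • e) < 0) : ∀ᶠ y' in 𝓝 y, r ∈ slice C e y' := by
  have hc : Continuous fun y : V => y + r • e := by fun_prop
  have hC' : y + r • e ∉ C' := fun h' => by
    rw [h.eq_zero _ hr h', P.discr_zero] at hd
    exact hd.false
  filter_upwards [(hc.tendsto y).eventually_mem (h.right.isClosed.isOpen_compl.mem_nhds hC'),
    ((P.continuous_discr.comp hc).tendsto y).eventually_lt_const hd] with y' hy1 hy2
  exact (h.mem_or_mem hy2.le).resolve_right hy1

theorem eventually_mem_slice_of_mem_Ioo (h : P.IsViewpoint C C' e) (hy : y ∈ shadow C e)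
    (hr : r ∈ Ioo (lo C e y) (hi C e y)) : ∀ᶠ y' in 𝓝 y, r ∈ slice C e y' :=
  h.eventually_mem_slice (h.slice_eq_Icc hy ▸ Ioo_subset_Icc_self hr)
    (h.discr_neg_of_mem_Ioo hy hr)

theorem continuousOn_lo (h : P.IsViewpoint C C' e) : ContinuousOn (lo C e) (shadow C e) := by
  intro y hy
  have hupper : ∀ O, IsOpen O → slice C e y ⊆ O → ∀ᶠ y' in 𝓝[shadow C e] y, lo C e y' ∈ O := by
    intro O hO hsub
    filter_upwards [(h.eventually_forall_mem_slice continuous_id (p := fun _ r => r ∈ O)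
      fun r hr => (continuous_snd.tendsto (y, r)).eventually_mem
        (hO.mem_nhds (hsub hr))).filter_mono nhdsWithin_le_nhds, self_mem_nhdsWithin] with y' hy' hS
    exact hy' _ (h.lo_mem hS)
  refine tendsto_order.mpr ⟨fun a ha => ?_, fun b hb => ?_⟩
  · exact hupper _ isOpen_Ioi fun r hr => ha.trans_le (h.lo_le hr)
  rcases (h.lo_le_hi hy).eq_or_lt with heq | hlt
  · exact hupper _ isOpen_Iio fun r hr => ((h.le_hi hr).trans_eq heq.symm).trans_lt hb
  · obtain ⟨r, hlo, hr⟩ := exists_between (lt_min hb hlt)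
    filter_upwards [(h.eventually_mem_slice_of_mem_Ioo hy
      ⟨hlo, hr.trans_le (min_le_right _ _)⟩).filter_mono nhdsWithin_le_nhds] with y' hy'
    exact (h.lo_le hy').trans_lt (hr.trans_le (min_le_left _ _))

theorem continuousOn_hi (h : P.IsViewpoint C C' e) : ContinuousOn (hi C e) (shadow C e) := by
  have hneg := h.neg.continuousOn_lo.fun_neg
  simpa only [lo_neg, shadow_neg, neg_neg] using hneg

theorem eventually_discr_nonneg (h : P.IsViewpoint C C' e) (hy : y ∈ shadow C e)
    (heq : lo C e y = hi C e y) : ∀ᶠ r in 𝓝 (lo C e y), 0 ≤ P.discr (y + r • e) := by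
  filter_upwards [h.eventually_discr_pos (h.lo_mem hy) (hy.2 _)] with r hr
  by_cases hmem : r ∈ slice C e y
  · rw [le_antisymm ((h.le_hi hmem).trans_eq heq.symm) (h.lo_le hmem), h.discr_lo hy]
  · exact (hr hmem).le

theorem discrDeriv_ne_zero (h : P.IsViewpoint C C' e) (hP : P.Smooth) (hy : y ∈ shadow C e)
    (heq : lo C e y = hi C e y) {v : V} (hspan : ∀ w, w ∈ Submodule.span ℝ {y, v, e}) :
    P.discrDeriv (y + lo C e y • e) v ≠ 0 := by
  intro hv
  have hmin : IsLocalMin (fun r => P.discr (y + r • e)) (lo C e y) := by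
    simpa only [IsLocalMin, IsMinFilter, h.discr_lo hy] using h.eventually_discr_nonneg hy heq
  have he : P.discrDeriv (y + lo C e y • e) e = 0 := by
    simpa using hmin.hasDerivAt_eq_zero (hasDerivAt_discr_line y e _)
  obtain ⟨w, hw⟩ := hP _ (hy.2 _) (h.discr_lo hy)
  obtain ⟨a, b, c, rfl⟩ := Submodule.mem_span_triple.mp (hspan w)
  refine hw ?_
  rw [show a • y + b • v + c • e
      = a • (y + lo C e y • e) + b • v + (c - a * lo C e y) • e by module]
  rw [P.discrDeriv_add, P.discrDeriv_add, P.discrDeriv_smul, P.discrDeriv_smul, P.discrDeriv_smul,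
    P.discrDeriv_self, h.discr_lo hy, hv, he]
  ring

theorem eventually_not_nonempty_slice (h : P.IsViewpoint C C' e) (hy : y ∈ shadow C e)
    (heq : lo C e y = hi C e y) {v : V} (hv : P.discrDeriv (y + lo C e y • e) v ≠ 0) :
    ∀ᶠ s : ℝ in 𝓝 0, 0 < P.discrDeriv (y + lo C e y • e) v * s →
      ¬ (slice C e (y + s • v)).Nonempty := by
  set κ := P.discrDeriv (y + lo C e y • e) v
  have hg : Continuous fun s : ℝ => y + s • v := by fun_prop
  have hslope : Continuous fun z : ℝ × ℝ => κ * P.slope (y + z.2 • e) v z.1 := by fun_prop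
  have hslope0 : 0 < κ * P.slope (y + lo C e y • e) v 0 := by
    rw [P.slope_zero, mul_left_comm]
    exact mul_pos two_pos (mul_self_pos.mpr hv)
  have hslice := h.eventually_forall_mem_slice hg (x₀ := 0)
    (p := fun s r => 0 < κ * P.slope (y + r • e) v s ∧ 0 ≤ P.discr (y + r • e)) fun r hr => ?_
  · filter_upwards [hslice] with s hs hκs
    rintro ⟨r, hr⟩
    obtain ⟨hpos, hnonneg⟩ := hs r hr
    have hd : P.discr (y + s • v + r • e) ≤ 0 := h.subset_left hr
    rw [add_right_comm, P.discr_add_smul] at hd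
    have hprod : 0 < κ * κ * (s * P.slope (y + r • e) v s) := by
      rw [← mul_mul_mul_comm]
      exact mul_pos hκs hpos
    linarith [pos_of_mul_pos_right hprod (mul_self_nonneg κ)]
  · rw [zero_smul, add_zero] at hr
    obtain rfl : r = lo C e y := le_antisymm ((h.le_hi hr).trans_eq heq.symm) (h.lo_le hr)
    have hev := (hslope.tendsto (0, lo C e y)).eventually_const_lt hslope0
    exact hev.and ((continuous_snd.tendsto (0, lo C e y)).eventually
      (h.eventually_discr_nonneg hy heq))

theorem eventually_nonempty_slice (h : P.IsViewpoint C C' e) (hy : y ∈ shadow C e) {v : V}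
    (hv : P.discrDeriv (y + lo C e y • e) v ≠ 0) :
    ∀ᶠ s : ℝ in 𝓝 0, P.discrDeriv (y + lo C e y • e) v * s < 0 →
      (slice C e (y + s • v)).Nonempty := by
  have hslope : Continuous fun s => P.discrDeriv (y + lo C e y • e) v
      * P.slope (y + lo C e y • e) v s := by fun_prop
  have hslope0 : 0 < P.discrDeriv (y + lo C e y • e) v * P.slope (y + lo C e y • e) v 0 := by
    rw [P.slope_zero, mul_left_comm]
    exact mul_pos two_pos (mul_self_pos.mpr hv)
  have hc : Continuous fun s : ℝ => y + lo C e y • e + s • v := by fun_prop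
  have hC' : y + lo C e y • e + (0 : ℝ) • v ∉ C' := by
    simpa using fun hmem => hy.2 _ (h.eq_zero _ (h.lo_mem hy) hmem)
  filter_upwards [(hslope.tendsto 0).eventually_const_lt hslope0,
    (hc.tendsto 0).eventually_mem (h.right.isClosed.isOpen_compl.mem_nhds hC')] with s hs hs' hκs
  have hd : P.discr (y + lo C e y • e + s • v) ≤ 0 := by
    have hprod := mul_neg_of_neg_of_pos hκs hs
    rw [mul_mul_mul_comm] at hprod
    rw [P.discr_add_smul, h.discr_lo hy, zero_add]
    exact (neg_of_mul_neg_right hprod (mul_self_nonneg _)).le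
  refine ⟨lo C e y, ?_⟩
  simpa only [slice, mem_ofPred_eq, add_right_comm] using (h.mem_or_mem hd).resolve_right hs'

end IsViewpoint

end QuadricFamily

/-! ### Parametrized discs in the plane -/

namespace ClosedDisc

theorem norm_sq_eq (x : ClosedDisc) : ‖x.1‖ ^ 2 = x.1 0 ^ 2 + x.1 1 ^ 2 := by
  rw [EuclideanSpace.real_norm_sq_eq, Fin.sum_univ_two]

theorem sq_add_sq_le (x : ClosedDisc) : x.1 0 ^ 2 + x.1 1 ^ 2 ≤ 1 :=
  x.norm_sq_eq ▸ pow_le_one₀ (norm_nonneg _) (mem_closedBall_zero_iff.mp x.2)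

theorem norm_eq_one_iff (x : ClosedDisc) : ‖x.1‖ = 1 ↔ x.1 0 ^ 2 + x.1 1 ^ 2 = 1 := by
  rw [← norm_sq_eq, pow_eq_one_iff_of_nonneg (norm_nonneg _) two_ne_zero]

theorem exists_coords {c d : ℝ} (h : c ^ 2 + d ^ 2 ≤ 1) : ∃ x : ClosedDisc, x.1 0 = c ∧ x.1 1 = d :=
  ⟨⟨!₂[c, d], by simpa [EuclideanSpace.norm_eq] using h⟩, by simp, by simp⟩

theorem ext_coords {x y : ClosedDisc} (h0 : x.1 0 = y.1 0) (h1 : x.1 1 = y.1 1) : x = y :=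
  Subtype.ext <| PiLp.ext <| Fin.forall_fin_two.mpr ⟨h0, h1⟩

theorem abscissa_mem (x : ClosedDisc) : x.1 0 ∈ Icc (-1) 1 :=
  abs_le.mp <| sq_le_one_iff_abs_le_one _ |>.mp <|
    (le_add_of_nonneg_right (sq_nonneg _)).trans x.sq_add_sq_le

theorem one_sub_sq_pos {c : ℝ} (hc : c ∈ Ioo (-1) 1) : 0 < 1 - c ^ 2 :=
  sub_pos.mpr (sq_lt_one_iff_abs_lt_one c |>.mpr (abs_lt.mpr hc))

/-- The position of a point of the disc on its vertical chord, scaled so that the end points of the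
chord have heights `-1` and `1`; the junk value on the two degenerate chords is `0`. -/
noncomputable def height (x : ClosedDisc) : ℝ := x.1 1 / √(1 - x.1 0 ^ 2)

theorem height_mem (x : ClosedDisc) : x.height ∈ Icc (-1) 1 := by
  refine abs_le.mp ?_
  rw [height, abs_div, abs_of_nonneg (Real.sqrt_nonneg _)]
  exact div_le_one_of_le₀ (Real.abs_le_sqrt (by linarith [x.sq_add_sq_le])) (Real.sqrt_nonneg _)

theorem continuousAt_height {x : ClosedDisc} (hx : x.1 0 ∈ Ioo (-1) 1) :
    ContinuousAt height x :=
  ContinuousAt.div (by fun_prop) (by fun_prop) (Real.sqrt_pos.mpr (one_sub_sq_pos hx)).ne'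

theorem norm_eq_one_iff_height {x : ClosedDisc} (hx : x.1 0 ∈ Ioo (-1) 1) :
    ‖x.1‖ = 1 ↔ x.height = -1 ∨ x.height = 1 := by
  have h := one_sub_sq_pos hx
  rw [norm_eq_one_iff, or_comm, ← sq_eq_one_iff, height, div_pow, Real.sq_sqrt h.le,
    div_eq_one_iff_eq h.ne', eq_sub_iff_add_eq']

theorem norm_eq_one_of_notMem {x : ClosedDisc} (hx : x.1 0 ∉ Ioo (-1) 1) :
    x.1 1 = 0 ∧ ‖x.1‖ = 1 := by
  have h : 1 ≤ x.1 0 ^ 2 := by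
    rw [one_le_sq_iff_one_le_abs]
    exact not_lt.mp fun h => hx (abs_lt.mp h)
  have := x.sq_add_sq_le
  exact ⟨pow_eq_zero_iff two_ne_zero |>.mp (by nlinarith [sq_nonneg (x.1 1)]),
    x.norm_eq_one_iff.mpr (by nlinarith [sq_nonneg (x.1 1)])⟩

theorem ext_height {x y : ClosedDisc} (h0 : x.1 0 = y.1 0)
    (h1 : x.1 0 ∈ Ioo (-1) 1 → x.height = y.height) : x = y := by
  refine ext_coords h0 ?_
  by_cases hx : x.1 0 ∈ Ioo (-1) 1
  · have h := h1 hx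
    rw [height, height, ← h0] at h
    exact (div_left_inj' (Real.sqrt_pos.mpr (one_sub_sq_pos hx)).ne').mp h
  · rw [(norm_eq_one_of_notMem hx).1, (norm_eq_one_of_notMem (h0 ▸ hx)).1]

theorem exists_height {c d : ℝ} (hc : c ∈ Icc (-1) 1) (hd : d ∈ Icc (-1) 1) :
    ∃ x : ClosedDisc, x.1 0 = c ∧ (c ∈ Ioo (-1) 1 → x.height = d) := by
  have hc2 : c ^ 2 ≤ 1 := sq_le_one_iff_abs_le_one c |>.mpr (abs_le.mpr hc)
  have hd2 : d ^ 2 ≤ 1 := sq_le_one_iff_abs_le_one d |>.mpr (abs_le.mpr hd)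
  obtain ⟨x, h0, h1⟩ := exists_coords (c := c) (d := d * √(1 - c ^ 2)) (by
    rw [mul_pow, Real.sq_sqrt (sub_nonneg.mpr hc2)]; nlinarith)
  refine ⟨x, h0, fun hc => ?_⟩
  rw [height, h0, h1, mul_div_cancel_right₀ _ (Real.sqrt_pos.mpr (one_sub_sq_pos hc)).ne']

end ClosedDisc

/-- The affine function of `c` with value `a` at `-1` and `b` at `1`. -/
noncomputable def interp (a b c : ℝ) : ℝ := (a + b) / 2 + (b - a) / 2 * c

section interp

variable {a b c d : ℝ}

theorem interp_left_iff (hab : a < b) : interp a b c = a ↔ c = -1 := by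
  rw [interp, ← sub_eq_zero, show (a + b) / 2 + (b - a) / 2 * c - a = (b - a) / 2 * (c + 1) by ring,
    mul_eq_zero_iff_left (by linarith), add_eq_zero_iff_eq_neg]

theorem interp_right_iff (hab : a < b) : interp a b c = b ↔ c = 1 := by
  rw [interp, ← sub_eq_zero, show (a + b) / 2 + (b - a) / 2 * c - b = (b - a) / 2 * (c - 1) by ring,
    mul_eq_zero_iff_left (by linarith), sub_eq_zero]

theorem interp_self (a c : ℝ) : interp a a c = a := by
  rw [interp]; ring

theorem interp_injective (hab : a < b) : Function.Injective (interp a b) := fun c d h => by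
  rw [interp, interp, add_right_inj] at h
  exact mul_left_cancel₀ (by linarith) h

theorem interp_mem_Icc (hab : a ≤ b) (hc : c ∈ Icc (-1) 1) : interp a b c ∈ Icc a b := by
  constructor <;> rw [interp] <;> nlinarith [hc.1, hc.2]

theorem exists_interp_eq (hab : a ≤ b) (hd : d ∈ Icc a b) : ∃ c ∈ Icc (-1) 1, interp a b c = d := by
  rcases hab.eq_or_lt with rfl | hab
  · exact ⟨0, by norm_num, (interp_self a 0).trans (le_antisymm hd.1 hd.2)⟩
  have hba : 0 < b - a := sub_pos.mpr hab
  refine ⟨(2 * d - a - b) / (b - a), ⟨?_, ?_⟩, ?_⟩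
  · rw [le_div_iff₀ hba]; linarith [hd.1]
  · rw [div_le_iff₀ hba]; linarith [hd.2]
  · rw [interp]; field_simp; ring

theorem interp_mem_Ioo_iff (hab : a < b) (hc : c ∈ Icc (-1) 1) :
    interp a b c ∈ Ioo a b ↔ c ∈ Ioo (-1) 1 := by
  have h := interp_mem_Icc hab.le hc
  simp only [mem_Ioo, h.1.lt_iff_ne', h.2.lt_iff_ne, hc.1.lt_iff_ne', hc.2.lt_iff_ne, ne_eq,
    interp_left_iff hab, interp_right_iff hab]

end interp

/-- Two continuous functions on `[a, b]` whose graphs meet over the end points only, so that they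
bound a lens-shaped region. -/
structure IsLens (a b : ℝ) (f g : ℝ → ℝ) : Prop where
  lt : a < b
  continuousOn_left : ContinuousOn f (Icc a b)
  continuousOn_right : ContinuousOn g (Icc a b)
  le : ∀ s ∈ Icc a b, f s ≤ g s
  lt_iff : ∀ s ∈ Icc a b, f s < g s ↔ s ∈ Ioo a b

/-- The parametrization of the region between the graphs of `f` and `g` over `[a, b]` by the unit
disc which maps vertical chords affinely to vertical segments. -/
noncomputable def lensMap (a b : ℝ) (f g : ℝ → ℝ) (x : ClosedDisc) : ℝ × ℝ :=
  (interp a b (x.1 0), interp (f (interp a b (x.1 0))) (g (interp a b (x.1 0))) x.height)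

namespace IsLens

variable {a b : ℝ} {f g : ℝ → ℝ}

theorem lensMap_mem (h : IsLens a b f g) (x : ClosedDisc) :
    (lensMap a b f g x).1 ∈ Icc a b ∧
      (lensMap a b f g x).2 ∈ Icc (f (lensMap a b f g x).1) (g (lensMap a b f g x).1) :=
  have h1 := interp_mem_Icc h.lt.le x.abscissa_mem
  ⟨h1, interp_mem_Icc (h.le _ h1) x.height_mem⟩

theorem lt_iff_abscissa_mem (h : IsLens a b f g) (x : ClosedDisc) :
    f (lensMap a b f g x).1 < g (lensMap a b f g x).1 ↔ x.1 0 ∈ Ioo (-1) 1 :=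
  (h.lt_iff _ (h.lensMap_mem x).1).trans (interp_mem_Ioo_iff h.lt x.abscissa_mem)

theorem eq_of_abscissa_notMem (h : IsLens a b f g) {x : ClosedDisc} (hx : x.1 0 ∉ Ioo (-1) 1) :
    f (lensMap a b f g x).1 = g (lensMap a b f g x).1 :=
  (h.le _ (h.lensMap_mem x).1).eq_of_not_lt (mt (h.lt_iff_abscissa_mem x).mp hx)

theorem continuous_lensMap (h : IsLens a b f g) : Continuous (lensMap a b f g) := by
  have hσ : Continuous fun x : ClosedDisc => interp a b (x.1 0) := by unfold interp; fun_prop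
  have hf := h.continuousOn_left.comp_continuous hσ fun x => (h.lensMap_mem x).1
  have hg := h.continuousOn_right.comp_continuous hσ fun x => (h.lensMap_mem x).1
  refine hσ.prodMk (((hf.add hg).div_const 2).add (continuous_iff_continuousAt.mpr fun x => ?_))
  have hd : ContinuousAt (fun x : ClosedDisc =>
      (g (interp a b (x.1 0)) - f (interp a b (x.1 0))) / 2) x :=
    ((hg.sub hf).div_const 2).continuousAt
  by_cases hx : x.1 0 ∈ Ioo (-1) 1
  · exact hd.mul (ClosedDisc.continuousAt_height hx)
  · have h0 : (g (interp a b (x.1 0)) - f (interp a b (x.1 0))) / 2 = 0 := by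
      have : f (interp a b (x.1 0)) = g (interp a b (x.1 0)) := h.eq_of_abscissa_notMem hx
      rw [this, sub_self, zero_div]
    rw [ContinuousAt, h0] at hd
    rw [ContinuousAt, h0, zero_mul]
    exact hd.zero_mul_isBoundedUnder_le (isBoundedUnder_of ⟨1, fun y => abs_le.mpr y.height_mem⟩)

theorem injective_lensMap (h : IsLens a b f g) : Function.Injective (lensMap a b f g) := by
  intro x y hxy
  have h0 : x.1 0 = y.1 0 := interp_injective h.lt (congrArg Prod.fst hxy)
  refine ClosedDisc.ext_height h0 fun hx =>
    interp_injective ((h.lt_iff_abscissa_mem x).mpr hx) ?_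
  have h2 := congrArg Prod.snd hxy
  simp only [lensMap, ← h0] at h2
  exact h2

theorem norm_eq_one_iff (h : IsLens a b f g) (x : ClosedDisc) :
    ‖x.1‖ = 1 ↔ (lensMap a b f g x).2 = f (lensMap a b f g x).1 ∨
      (lensMap a b f g x).2 = g (lensMap a b f g x).1 := by
  by_cases hx : x.1 0 ∈ Ioo (-1) 1
  · have hlt := (h.lt_iff_abscissa_mem x).mpr hx
    rw [ClosedDisc.norm_eq_one_iff_height hx, ← interp_left_iff hlt, ← interp_right_iff hlt]
    rfl
  · refine iff_of_true (ClosedDisc.norm_eq_one_of_notMem hx).2 (Or.inl ?_)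
    have := (h.lensMap_mem x).2
    rw [← h.eq_of_abscissa_notMem hx, Icc_self] at this
    exact this

theorem exists_lensMap_eq (h : IsLens a b f g) {s r : ℝ} (hs : s ∈ Icc a b)
    (hr : r ∈ Icc (f s) (g s)) : ∃ x, lensMap a b f g x = (s, r) := by
  obtain ⟨c, hc, rfl⟩ := exists_interp_eq h.lt.le hs
  obtain ⟨d, hd, rfl⟩ := exists_interp_eq (h.le _ hs) hr
  obtain ⟨x, rfl, hx⟩ := ClosedDisc.exists_height hc hd
  refine ⟨x, Prod.ext rfl ?_⟩
  by_cases h0 : x.1 0 ∈ Ioo (-1) 1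
  · rw [← hx h0]; rfl
  · have := h.eq_of_abscissa_notMem h0
    simp only [lensMap] at this ⊢
    rw [this, interp_self, interp_self]

end IsLens

/-! ### The real projective plane -/

namespace RP2

theorem isQuotientMap_mk' :
    IsQuotientMap (Projectivization.mk' ℝ : {v : Fin 3 → ℝ // v ≠ 0} → RP2) :=
  isQuotientMap_quot_mk

theorem continuous_mk {X : Type*} [TopologicalSpace X] {F : X → Fin 3 → ℝ} (hF : Continuous F)
    (h0 : ∀ x, F x ≠ 0) : Continuous fun x => (Projectivization.mk ℝ (F x) (h0 x) : RP2) :=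
  isQuotientMap_mk'.continuous.comp (hF.subtype_mk h0)

theorem exists_unit_mk_eq (p : RP2) : ∃ x : Metric.sphere (0 : Fin 3 → ℝ) 1,
    Projectivization.mk ℝ x.1 (ne_zero_of_mem_unit_sphere x) = p := by
  have hp := norm_ne_zero_iff.mpr p.rep_nonzero
  refine ⟨⟨‖p.rep‖⁻¹ • p.rep, ?_⟩, ?_⟩
  · rw [mem_sphere_zero_iff_norm, norm_smul, norm_inv, norm_norm, inv_mul_cancel₀ hp]
  · conv_rhs => rw [← p.mk_rep]
    exact (Projectivization.mk_eq_mk_iff' ℝ _ _ _ _).mpr ⟨_, rfl⟩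

instance : CompactSpace RP2 :=
  Function.Surjective.compactSpace
    (continuous_mk continuous_subtype_val ne_zero_of_mem_unit_sphere) exists_unit_mk_eq

/-- The coordinates `xᵢ xⱼ / |x|²` separate the points of the projective plane; they serve to see
that it is Hausdorff. -/
noncomputable def veronese (p : RP2) (i j : Fin 3) : ℝ := p.rep i * p.rep j / (p.rep ⬝ᵥ p.rep)

theorem veronese_mk (x : Fin 3 → ℝ) (hx : x ≠ 0) (i j : Fin 3) :
    veronese (Projectivization.mk ℝ x hx) i j = x i * x j / (x ⬝ᵥ x) := by
  obtain ⟨a, ha⟩ := Projectivization.exists_smul_eq_mk_rep ℝ x hx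
  have ha0 := a.ne_zero
  have hxx : x ⬝ᵥ x ≠ 0 := mt dotProduct_self_eq_zero.mp hx
  rw [veronese, ← ha]
  simp only [Units.smul_def, Pi.smul_apply, smul_eq_mul, dotProduct_smul, smul_dotProduct]
  field_simp

theorem continuous_veronese : Continuous veronese := by
  rw [isQuotientMap_mk'.continuous_iff]
  refine continuous_pi fun i => continuous_pi fun j => Continuous.congr (f := fun x =>
    x.1 i * x.1 j / (x.1 ⬝ᵥ x.1)) ?_ fun x => (veronese_mk x.1 x.2 i j).symm
  have hi (i) : Continuous fun x : {v : Fin 3 → ℝ // v ≠ 0} => x.1 i :=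
    (continuous_apply i).comp continuous_subtype_val
  exact ((hi i).mul (hi j)).div (continuous_subtype_val.dotProduct continuous_subtype_val)
    fun x => mt dotProduct_self_eq_zero.mp x.2

theorem veronese_injective : Function.Injective veronese := by
  intro p q hpq
  induction p using Projectivization.ind with | h x hx
  induction q using Projectivization.ind with | h y hy
  have hxx : x ⬝ᵥ x ≠ 0 := mt dotProduct_self_eq_zero.mp hx
  have hyy : y ⬝ᵥ y ≠ 0 := mt dotProduct_self_eq_zero.mp hy
  obtain ⟨k, hk⟩ := Function.ne_iff.mp hx
  rw [Pi.zero_apply] at hk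
  rw [Projectivization.mk_eq_mk_iff']
  refine ⟨(x ⬝ᵥ x) * y k / ((y ⬝ᵥ y) * x k), funext fun i => ?_⟩
  have := congrFun (congrFun hpq i) k
  rw [veronese_mk, veronese_mk, div_eq_div_iff hxx hyy] at this
  simp only [Pi.smul_apply, smul_eq_mul]
  field_simp
  linarith

instance : T2Space RP2 := T2Space.of_injective_continuous veronese_injective continuous_veronese

theorem isEmbedding_of_injective {φ : ClosedDisc → RP2} (hφ : Continuous φ)
    (hinj : Function.Injective φ) : IsEmbedding φ :=
  (hφ.isClosedEmbedding hinj).isEmbedding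

end RP2

/-- The points of the projective plane whose homogeneous coordinates lie in `C`; a chosen
representative is used, so this is meaningful for sets `C` stable under nonzero scalars. -/
def projSet (C : Set (Fin 3 → ℝ)) : Set RP2 := {p | p.rep ∈ C}

section projSet

variable {C : Set (Fin 3 → ℝ)}

theorem mk_mem_projSet (hC : ∀ c : ℝ, c ≠ 0 → ∀ x ∈ C, c • x ∈ C) {x : Fin 3 → ℝ} (hx : x ≠ 0) :
    Projectivization.mk ℝ x hx ∈ projSet C ↔ x ∈ C := by
  obtain ⟨a, ha⟩ := Projectivization.exists_smul_eq_mk_rep ℝ x hx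
  rw [projSet, mem_ofPred_eq, ← ha]
  refine ⟨fun h => ?_, fun h => hC a a.ne_zero x h⟩
  have := hC (a : ℝ)⁻¹ (inv_ne_zero a.ne_zero) _ h
  rwa [Units.smul_def, inv_smul_smul₀ a.ne_zero] at this

theorem IsProjCone.mk_mem_projSet (hC : IsProjCone C) {x : Fin 3 → ℝ} (hx : x ≠ 0) :
    Projectivization.mk ℝ x hx ∈ projSet C ↔ x ∈ C :=
  _root_.mk_mem_projSet (fun c _ => hC.smul_mem c) hx

theorem IsProjCone.isClosed_projSet (hC : IsProjCone C) : IsClosed (projSet C) := by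
  rw [← RP2.isQuotientMap_mk'.isClosed_preimage]
  convert hC.isClosed.preimage (continuous_subtype_val (p := fun v : Fin 3 → ℝ => v ≠ 0)) using 1
  ext x
  exact hC.mk_mem_projSet x.2

theorem continuousOn_comp_rep {Y : Type*} [TopologicalSpace Y] (hC : IsOpen C)
    (hCs : ∀ c : ℝ, c ≠ 0 → ∀ x ∈ C, c • x ∈ C) {G : (Fin 3 → ℝ) → Y} (hG : ContinuousOn G C)
    (hGs : ∀ c : ℝ, c ≠ 0 → ∀ x, G (c • x) = G x) :
    ContinuousOn (fun p : RP2 => G p.rep) (projSet C) := by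
  have hpre : (Projectivization.mk' ℝ : {v : Fin 3 → ℝ // v ≠ 0} → RP2) ⁻¹' projSet C
      = Subtype.val ⁻¹' C := ext fun x => mk_mem_projSet hCs x.2
  have hcomp : (fun p : RP2 => G p.rep) ∘ (Projectivization.mk' ℝ : {v : Fin 3 → ℝ // v ≠ 0} → RP2)
      = fun x => G x.1 := funext fun x => by
    obtain ⟨a, ha⟩ := Projectivization.exists_smul_eq_mk_rep ℝ x.1 x.2
    exact (congrArg G ha).symm.trans (hGs a a.ne_zero x.1)
  have hopen : IsOpen (projSet C) := by
    rw [← RP2.isQuotientMap_mk'.isOpen_preimage, hpre]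
    exact hC.preimage continuous_subtype_val
  rw [RP2.isQuotientMap_mk'.continuousOn_isOpen_iff hopen, hpre, hcomp]
  exact hG.comp continuous_subtype_val.continuousOn fun x hx => hx

end projSet

theorem exists_basis_of_linearIndependent {v e : Fin 3 → ℝ} (h : LinearIndependent ℝ ![v, e]) :
    ∃ B : Module.Basis (Fin 3) ℝ (Fin 3 → ℝ), B 1 = v ∧ B 2 = e := by
  obtain ⟨u, hu⟩ := exists_linearIndependent_cons_of_lt_finrank h (by simp)
  exact ⟨basisOfLinearIndependentOfCardEqFinrank hu (by simp), by simp, by simp⟩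

/-! ### Affine charts -/

section Chart

variable (B : Module.Basis (Fin 3) ℝ (Fin 3 → ℝ))

theorem eq_sum_coord (x : Fin 3 → ℝ) :
    x = B.coord 0 x • B 0 + B.coord 1 x • B 1 + B.coord 2 x • B 2 := by
  rw [← Fin.sum_univ_three fun i => B.coord i x • B i]
  exact (B.sum_repr x).symm

/-- Homogeneous coordinates for the point with affine coordinates `q` in the chart of `B`, whose
line at infinity passes through `B 1` and `B 2`. -/
noncomputable def chartVec (q : ℝ × ℝ) : Fin 3 → ℝ := B 0 + q.1 • B 1 + q.2 • B 2

theorem coord_chartVec (q : ℝ × ℝ) :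
    B.coord 0 (chartVec B q) = 1 ∧ B.coord 1 (chartVec B q) = q.1 ∧
      B.coord 2 (chartVec B q) = q.2 := by
  simp [chartVec]

theorem chartVec_ne_zero (q : ℝ × ℝ) : chartVec B q ≠ 0 := fun h => by
  simpa [h] using (coord_chartVec B q).1

theorem mem_span_chart (s : ℝ) (w : Fin 3 → ℝ) :
    w ∈ Submodule.span ℝ {B 0 + s • B 1, B 1, B 2} := by
  refine Submodule.mem_span_triple.mpr
    ⟨B.coord 0 w, B.coord 1 w - B.coord 0 w * s, B.coord 2 w, ?_⟩
  conv_rhs => rw [eq_sum_coord B w]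
  module

/-- The affine chart of the projective plane belonging to the basis `B`. -/
noncomputable def chart (q : ℝ × ℝ) : RP2 := Projectivization.mk ℝ (chartVec B q)
  (chartVec_ne_zero B q)

/-- The affine coordinates of a point in the chart of `B`, with junk values at infinity. -/
noncomputable def affineCoords (x : Fin 3 → ℝ) : ℝ × ℝ :=
  (B.coord 1 x / B.coord 0 x, B.coord 2 x / B.coord 0 x)

theorem affineCoords_chartVec (q : ℝ × ℝ) : affineCoords B (chartVec B q) = q := by
  obtain ⟨h0, h1, h2⟩ := coord_chartVec B q
  rw [affineCoords, h0, h1, h2, div_one, div_one]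

theorem affineCoords_smul {c : ℝ} (hc : c ≠ 0) (x : Fin 3 → ℝ) :
    affineCoords B (c • x) = affineCoords B x := by
  simp only [affineCoords, map_smul, smul_eq_mul, mul_div_mul_left _ _ hc]

theorem affineCoords_rep_mk {x : Fin 3 → ℝ} (hx : x ≠ 0) :
    affineCoords B (Projectivization.mk ℝ x hx).rep = affineCoords B x := by
  obtain ⟨a, ha⟩ := Projectivization.exists_smul_eq_mk_rep ℝ x hx
  exact (congrArg _ ha).symm.trans (affineCoords_smul B a.ne_zero x)

theorem chartVec_affineCoords {x : Fin 3 → ℝ} (hx : B.coord 0 x ≠ 0) :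
    chartVec B (affineCoords B x) = (B.coord 0 x)⁻¹ • x := by
  rw [eq_inv_smul_iff₀ hx, chartVec, affineCoords, smul_add, smul_add, smul_smul, smul_smul,
    mul_div_cancel₀ _ hx, mul_div_cancel₀ _ hx]
  exact (eq_sum_coord B x).symm

theorem chart_affineCoords_rep {p : RP2} (hp : B.coord 0 p.rep ≠ 0) :
    chart B (affineCoords B p.rep) = p := by
  conv_rhs => rw [← p.mk_rep]
  exact (Projectivization.mk_eq_mk_iff' ℝ _ _ _ _).mpr ⟨_, (chartVec_affineCoords B hp).symm⟩

theorem continuous_chart : Continuous (chart B) :=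
  RP2.continuous_mk (by unfold chartVec; fun_prop) _

theorem chart_injective : Function.Injective (chart B) := fun q q' h => by
  have := congrArg (fun p => affineCoords B p.rep) h
  simpa only [chart, affineCoords_rep_mk, affineCoords_chartVec] using this

theorem continuousOn_affineCoords_rep :
    ContinuousOn (fun p : RP2 => affineCoords B p.rep) (projSet {x | B.coord 0 x ≠ 0}) := by
  have hc (i) : Continuous (B.coord i) := LinearMap.continuous_of_finiteDimensional _
  refine continuousOn_comp_rep (isOpen_ne_fun (hc 0) continuous_const) (fun c hc x hx => ?_)
    (((hc 1).continuousOn.div (hc 0).continuousOn fun x hx => hx).prodMk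
      ((hc 2).continuousOn.div (hc 0).continuousOn fun x hx => hx))
    fun c hc => affineCoords_smul B hc
  rw [mem_ofPred_eq, map_smul]
  exact mul_ne_zero hc hx

end Chart

/-! ### A component missed by a line is a disc -/

theorem frequently_mul_pos {κ : ℝ} (hκ : κ ≠ 0) : ∃ᶠ t : ℝ in 𝓝 0, 0 < κ * t := by
  have hlim : Tendsto (fun t : ℝ => t * κ) (𝓝[>] 0) (𝓝 0) := by
    have : Continuous fun t : ℝ => t * κ := by fun_prop
    simpa using (this.tendsto 0).mono_left nhdsWithin_le_nhds
  refine hlim.frequently (Eventually.frequently ?_)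
  filter_upwards [self_mem_nhdsWithin] with t (ht : 0 < t)
  rw [mul_left_comm]
  exact mul_pos ht (mul_self_pos.mpr hκ)

/-- The parameters `s` of the lines through `B 2` and `B 0 + s • B 1` which meet `C`: the
projection of `C` from the point `B 2`. -/
def columns (B : Module.Basis (Fin 3) ℝ (Fin 3 → ℝ)) (C : Set (Fin 3 → ℝ)) : Set ℝ :=
  {s | (slice C (B 2) (B 0 + s • B 1)).Nonempty}

/-- The part in `C` of the discriminant curve is an oval whose inside lies in `C`. -/
def QuadricFamily.IsOvalIn (P : QuadricFamily (Fin 3 → ℝ)) (C : Set (Fin 3 → ℝ)) : Prop :=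
  ∃ φ : ClosedDisc → RP2, IsEmbedding φ ∧ range φ ⊆ projSet C ∧
    discBoundary φ = projSet C ∩ projSet {x | P.discr x = 0}

theorem QuadricFamily.isProjCone_discr_eq_zero (P : QuadricFamily (Fin 3 → ℝ)) :
    IsProjCone {x | P.discr x = 0} where
  isClosed := isClosed_eq P.continuous_discr continuous_const
  smul_mem c x hx := by
    have hx : P.discr x = 0 := hx
    rw [mem_ofPred_eq, P.discr_smul, hx, mul_zero]

namespace QuadricFamily.IsViewpoint

variable {P : QuadricFamily (Fin 3 → ℝ)} {C C' : Set (Fin 3 → ℝ)}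
  {B : Module.Basis (Fin 3) ℝ (Fin 3 → ℝ)} {s a b : ℝ}

theorem mem_shadow_of_mem_columns (hs : s ∈ columns B C) : B 0 + s • B 1 ∈ shadow C (B 2) :=
  ⟨hs, fun r => chartVec_ne_zero B (s, r)⟩

theorem continuous_column : Continuous fun s : ℝ => B 0 + s • B 1 := by fun_prop

theorem coord_ne_zero (h : P.IsViewpoint C C' (B 2)) (hB : ¬ (slice C (B 2) (B 1)).Nonempty)
    {x : Fin 3 → ℝ} (hx : x ∈ C) (hx0 : x ≠ 0) : B.coord 0 x ≠ 0 := by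
  intro h0
  have hsum := eq_sum_coord B x
  rw [h0, zero_smul, zero_add] at hsum
  by_cases h1 : B.coord 1 x = 0
  · rw [h1, zero_smul, zero_add] at hsum
    have h2 : B.coord 2 x ≠ 0 := fun h2 => hx0 (by rw [hsum, h2, zero_smul])
    apply h.notMem_left
    rw [← inv_smul_smul₀ h2 (B 2), ← hsum]
    exact h.left.smul_mem _ _ hx
  · refine hB ⟨B.coord 2 x / B.coord 1 x, ?_⟩
    have := h.left.smul_mem (B.coord 1 x)⁻¹ x hx
    nth_rewrite 2 [hsum] at this
    rwa [smul_add, inv_smul_smul₀ h1, smul_smul, inv_mul_eq_div] at this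

theorem affineCoords_mem_slice (h : P.IsViewpoint C C' (B 2))
    (hB : ¬ (slice C (B 2) (B 1)).Nonempty) {x : Fin 3 → ℝ} (hx : x ∈ C) (hx0 : x ≠ 0) :
    (affineCoords B x).2 ∈ slice C (B 2) (B 0 + (affineCoords B x).1 • B 1) := by
  have := h.left.smul_mem (B.coord 0 x)⁻¹ x hx
  rwa [← chartVec_affineCoords B (h.coord_ne_zero hB hx hx0)] at this

theorem columns_eq_image (h : P.IsViewpoint C C' (B 2)) (hB : ¬ (slice C (B 2) (B 1)).Nonempty) :
    columns B C = (fun p : RP2 => (affineCoords B p.rep).1) '' projSet C := by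
  apply Subset.antisymm
  · rintro s ⟨r, hr⟩
    refine ⟨chart B (s, r), (h.left.mk_mem_projSet _).mpr hr, ?_⟩
    simp only [chart, affineCoords_rep_mk, affineCoords_chartVec]
  · rintro _ ⟨p, hp, rfl⟩
    exact ⟨_, h.affineCoords_mem_slice hB hp p.rep_nonzero⟩

theorem exists_columns_eq_Icc (h : P.IsViewpoint C C' (B 2))
    (hB : ¬ (slice C (B 2) (B 1)).Nonempty) (hconn : IsConnected (projSet C)) :
    ∃ a b, a ≤ b ∧ columns B C = Icc a b := by
  have hcont : ContinuousOn (fun p : RP2 => (affineCoords B p.rep).1) (projSet C) :=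
    continuous_fst.comp_continuousOn <| (continuousOn_affineCoords_rep B).mono
      fun p hp => h.coord_ne_zero hB hp p.rep_nonzero
  have hcomp : IsCompact (columns B C) := h.columns_eq_image hB ▸
    h.left.isClosed_projSet.isCompact.image_of_continuousOn hcont
  have hconn : IsConnected (columns B C) := h.columns_eq_image hB ▸ hconn.image _ hcont
  exact ⟨_, _, csInf_le_csSup hconn.nonempty hcomp.bddBelow hcomp.bddAbove,
    eq_Icc_of_connected_compact hconn hcomp⟩

theorem columns_mem_nhds (h : P.IsViewpoint C C' (B 2)) (hs : s ∈ columns B C)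
    (hlt : lo C (B 2) (B 0 + s • B 1) < hi C (B 2) (B 0 + s • B 1)) : columns B C ∈ 𝓝 s := by
  obtain ⟨r, hr⟩ := exists_between hlt
  filter_upwards [(continuous_column.tendsto s).eventually
    (h.eventually_mem_slice_of_mem_Ioo (mem_shadow_of_mem_columns hs) hr)] with s' hs'
  exact ⟨r, hs'⟩

theorem frequently_columns_of_lo_eq_hi (h : P.IsViewpoint C C' (B 2)) (hP : P.Smooth)
    (hs : s ∈ columns B C)
    (heq : lo C (B 2) (B 0 + s • B 1) = hi C (B 2) (B 0 + s • B 1)) :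
    (∃ᶠ s' in 𝓝 s, s' ∉ columns B C) ∧ ∃ᶠ s' in 𝓝 s, s' ∈ columns B C ∧ s' ≠ s := by
  have hy := mem_shadow_of_mem_columns hs
  have hκ := h.discrDeriv_ne_zero hP hy heq (mem_span_chart B s)
  set κ := P.discrDeriv (B 0 + s • B 1 + lo C (B 2) (B 0 + s • B 1) • B 2) (B 1)
  have hlim : Tendsto (fun t : ℝ => s + t) (𝓝 0) (𝓝 s) := by
    simpa using (continuous_const_add s).tendsto 0
  have hiff (t : ℝ) : (slice C (B 2) (B 0 + s • B 1 + t • B 1)).Nonempty ↔ s + t ∈ columns B C := by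
    rw [add_assoc, ← add_smul]; rfl
  constructor
  · refine hlim.frequently <| ((frequently_mul_pos hκ).and_eventually
      (h.eventually_not_nonempty_slice hy heq hκ)).mono fun t ht => ?_
    exact mt (hiff t).mpr (ht.2 ht.1)
  · refine hlim.frequently <| ((frequently_mul_pos (neg_ne_zero.mpr hκ)).and_eventually
      (h.eventually_nonempty_slice hy hκ)).mono fun t ht => ?_
    rw [neg_mul, neg_pos] at ht
    refine ⟨(hiff t).mp (ht.2 ht.1), fun h0 => ?_⟩
    rw [add_eq_left.mp h0, mul_zero] at ht
    exact lt_irrefl _ ht.1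

theorem isLens (h : P.IsViewpoint C C' (B 2)) (hP : P.Smooth) (hab : a ≤ b)
    (hS : columns B C = Icc a b) :
    IsLens a b (fun s => lo C (B 2) (B 0 + s • B 1)) (fun s => hi C (B 2) (B 0 + s • B 1)) := by
  have hmem {s : ℝ} (hs : s ∈ Icc a b) := mem_shadow_of_mem_columns (hS ▸ hs)
  have hle (s) (hs : s ∈ Icc a b) := h.lo_le_hi (hmem hs)
  have htan {s : ℝ} (hs : s ∈ Icc a b) := h.frequently_columns_of_lo_eq_hi hP (hS ▸ hs)
  have hlt (s) (hs : s ∈ Icc a b) :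
      lo C (B 2) (B 0 + s • B 1) < hi C (B 2) (B 0 + s • B 1) ↔ s ∈ Ioo a b := by
    refine ⟨fun hlt => ?_, fun hs' => (hle s hs).lt_of_ne fun heq => (htan hs heq).1 ?_⟩
    · have := h.columns_mem_nhds (hS ▸ hs) hlt
      rwa [hS, ← mem_interior_iff_mem_nhds, interior_Icc] at this
    · filter_upwards [Icc_mem_nhds hs'.1 hs'.2] with s' hs'
      rwa [hS, not_not]
  refine ⟨hab.lt_of_ne ?_, (h.continuousOn_lo).comp continuous_column.continuousOn fun s => hmem,
    (h.continuousOn_hi).comp continuous_column.continuousOn fun s => hmem, hle, hlt⟩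
  rintro rfl
  have ha : a ∈ Icc a a := ⟨le_rfl, le_rfl⟩
  have heq := (hle a ha).eq_of_not_lt fun h => lt_irrefl _ ((hlt a ha).mp h).1
  obtain ⟨s, hs, hne⟩ := (htan ha heq).2.exists
  rw [hS, Icc_self] at hs
  exact hne hs

theorem discBoundary_chart_lensMap (h : P.IsViewpoint C C' (B 2)) (hP : P.Smooth)
    (hB : ¬ (slice C (B 2) (B 1)).Nonempty) (hab : a ≤ b) (hS : columns B C = Icc a b) :
    discBoundary (fun x => chart B (lensMap a b (fun s => lo C (B 2) (B 0 + s • B 1))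
      (fun s => hi C (B 2) (B 0 + s • B 1)) x)) = projSet C ∩ projSet {x | P.discr x = 0} := by
  have hL := h.isLens hP hab hS
  have hmem {s : ℝ} (hs : s ∈ Icc a b) := mem_shadow_of_mem_columns (hS ▸ hs)
  apply Subset.antisymm
  · rintro _ ⟨x, hx, rfl⟩
    obtain ⟨h1, h2⟩ := hL.lensMap_mem x
    rw [← h.slice_eq_Icc (hmem h1)] at h2
    exact ⟨(h.left.mk_mem_projSet _).mpr h2, (P.isProjCone_discr_eq_zero.mk_mem_projSet _).mpr
      ((h.discr_eq_zero_iff (hmem h1) h2).mpr ((hL.norm_eq_one_iff x).mp hx))⟩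
  · rintro p ⟨hpC, hpD⟩
    have h0 := h.coord_ne_zero hB hpC p.rep_nonzero
    have hr := h.affineCoords_mem_slice hB hpC p.rep_nonzero
    have hs : (affineCoords B p.rep).1 ∈ Icc a b := hS ▸ ⟨_, hr⟩
    obtain ⟨x, hx⟩ := hL.exists_lensMap_eq hs (h.slice_eq_Icc (hmem hs) ▸ hr)
    refine ⟨x, (hL.norm_eq_one_iff x).mpr ?_, ?_⟩
    · rw [hx]
      refine (h.discr_eq_zero_iff (hmem hs) hr).mp ?_
      have := P.isProjCone_discr_eq_zero.smul_mem (B.coord 0 p.rep)⁻¹ _ hpD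
      rwa [← chartVec_affineCoords B h0] at this
    · simp only [hx]
      exact chart_affineCoords_rep B h0

theorem isOvalIn {e v : Fin 3 → ℝ} (h : P.IsViewpoint C C' e) (hP : P.Smooth)
    (hconn : IsConnected (projSet C)) (hv : ∀ r : ℝ, v + r • e ≠ 0)
    (hve : ¬ (slice C e v).Nonempty) : P.IsOvalIn C := by
  have hli : LinearIndependent ℝ ![v, e] := LinearIndependent.pair_symm_iff.mp <|
    (LinearIndependent.pair_iff' h.ne_zero).mpr fun r hr => hv (-r) (by rw [← hr]; module)
  obtain ⟨B, rfl, rfl⟩ := exists_basis_of_linearIndependent hli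
  obtain ⟨a, b, hab, hS⟩ := h.exists_columns_eq_Icc hve hconn
  have hL := h.isLens hP hab hS
  refine ⟨_, RP2.isEmbedding_of_injective ((continuous_chart B).comp hL.continuous_lensMap)
    ((chart_injective B).comp hL.injective_lensMap), ?_,
    h.discBoundary_chart_lensMap hP hve hab hS⟩
  rintro _ ⟨x, rfl⟩
  obtain ⟨h1, h2⟩ := hL.lensMap_mem x
  rw [← h.slice_eq_Icc (mem_shadow_of_mem_columns (hS ▸ h1))] at h2
  exact (h.left.mk_mem_projSet _).mpr h2

end QuadricFamily.IsViewpoint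

/-! ### A component met by every line is a band -/

section RadialGauge

variable {E : Type*} [NormedAddCommGroup E] [NormedSpace ℝ E]

/-- A continuous gauge, not necessarily convex, of a star-shaped neighbourhood of the origin. -/
structure IsRadialGauge (k : E → ℝ) : Prop where
  continuousOn : ContinuousOn k {0}ᶜ
  pos : ∀ z, z ≠ 0 → 0 < k z
  smul : ∀ c : ℝ, 0 < c → ∀ z, k (c • z) = c * k z

/-- The radial rescaling which maps the unit ball onto the sublevel set `{k ≤ 1}`. -/
noncomputable def radialMap (k : E → ℝ) (x : E) : E := (‖x‖ / k x) • x

namespace IsRadialGauge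

variable {k : E → ℝ}

theorem map_zero (h : IsRadialGauge k) : k 0 = 0 := by
  have := h.smul 2 two_pos 0
  rw [smul_zero] at this
  linarith

theorem apply_radialMap (h : IsRadialGauge k) (x : E) : k (radialMap k x) = ‖x‖ := by
  rcases eq_or_ne x 0 with rfl | hx
  · rw [radialMap, smul_zero, h.map_zero, norm_zero]
  · have hk := h.pos x hx
    rw [radialMap, h.smul _ (by positivity), div_mul_cancel₀ _ hk.ne']

theorem radialMap_injective (h : IsRadialGauge k) : Function.Injective (radialMap k) := by
  refine Function.LeftInverse.injective (g := fun z => (k z / ‖z‖) • z) fun x => ?_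
  rcases eq_or_ne x 0 with rfl | hx
  · simp only [radialMap, smul_zero]
  · have hk := h.pos x hx
    have hnorm : ‖radialMap k x‖ = ‖x‖ / k x * ‖x‖ := by
      rw [radialMap, norm_smul, Real.norm_of_nonneg (by positivity)]
    simp only [h.apply_radialMap, hnorm]
    rw [radialMap, smul_smul]
    convert one_smul ℝ x
    field_simp

theorem radialMap_surjective (h : IsRadialGauge k) : Function.Surjective (radialMap k) := by
  intro z
  rcases eq_or_ne z 0 with rfl | hz
  · exact ⟨0, smul_zero _⟩
  · have hk := h.pos z hz
    refine ⟨(k z / ‖z‖) • z, ?_⟩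
    rw [radialMap, h.smul _ (by positivity), norm_smul, Real.norm_of_nonneg (by positivity),
      smul_smul]
    convert one_smul ℝ z
    field_simp

theorem exists_mul_norm_le [ProperSpace E] [Nontrivial E] (h : IsRadialGauge k) :
    ∃ c : ℝ, 0 < c ∧ ∀ z, c * ‖z‖ ≤ k z := by
  have hsub : Metric.sphere (0 : E) 1 ⊆ {0}ᶜ := fun z hz => ne_zero_of_mem_unit_sphere ⟨z, hz⟩
  obtain ⟨z₀, hz₀, hmin⟩ := (isCompact_sphere (0 : E) 1).exists_isMinOn
    (NormedSpace.sphere_nonempty.mpr zero_le_one) (h.continuousOn.mono hsub)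
  refine ⟨k z₀, h.pos _ (hsub hz₀), fun z => ?_⟩
  rcases eq_or_ne z 0 with rfl | hz
  · rw [norm_zero, mul_zero, h.map_zero]
  · have hn := norm_pos_iff.mpr hz
    have hle : k z₀ ≤ k (‖z‖⁻¹ • z) := hmin (by simp [norm_smul, hn.ne'])
    rwa [h.smul _ (by positivity), inv_mul_eq_div, le_div_iff₀ hn] at hle

theorem continuous_radialMap [ProperSpace E] [Nontrivial E] (h : IsRadialGauge k) :
    Continuous (radialMap k) := by
  obtain ⟨c, hc, hle⟩ := h.exists_mul_norm_le
  refine continuous_iff_continuousAt.mpr fun x => ?_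
  rcases eq_or_ne x 0 with rfl | hx
  · have hlim : Tendsto (fun y : E => ‖y‖ / c) (𝓝 0) (𝓝 0) := by
      have hcont : Continuous fun y : E => ‖y‖ / c := by fun_prop
      simpa using hcont.tendsto 0
    rw [ContinuousAt, radialMap, smul_zero]
    refine squeeze_zero_norm (fun y => ?_) hlim
    rw [le_div_iff₀ hc, mul_comm, ← h.apply_radialMap y]
    exact hle _
  · have hk := h.continuousOn.continuousAt (isOpen_compl_singleton.mem_nhds hx)
    exact (continuousAt_id.norm.div hk (h.pos x hx).ne').smul continuousAt_id

end IsRadialGauge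

end RadialGauge

section SliceScaling

variable {V : Type*} [AddCommGroup V] [Module ℝ V] [TopologicalSpace V] {C : Set V} {e : V} {c : ℝ}

open Pointwise in
theorem IsProjCone.slice_smul (hC : IsProjCone C) (y : V) (hc : c ≠ 0) :
    slice C e (c • y) = c • slice C e y := by
  ext r
  rw [mem_smul_set_iff_inv_smul_mem₀ hc, smul_eq_mul]
  have hvec : y + (c⁻¹ * r) • e = c⁻¹ • (c • y + r • e) := by
    rw [smul_add, inv_smul_smul₀ hc, smul_smul]
  refine ⟨fun hr => ?_, fun hr => ?_⟩
  · rw [slice, mem_ofPred_eq, hvec]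
    exact hC.smul_mem c⁻¹ _ hr
  · rw [slice, mem_ofPred_eq, hvec] at hr
    rw [slice, mem_ofPred_eq, ← smul_inv_smul₀ hc (c • y + r • e)]
    exact hC.smul_mem c _ hr

theorem IsProjCone.lo_smul_of_pos (hC : IsProjCone C) (y : V) (hc : 0 < c) :
    lo C e (c • y) = c * lo C e y := by
  rw [lo, hC.slice_smul y hc.ne', Real.sInf_smul_of_nonneg hc.le, smul_eq_mul, lo]

theorem IsProjCone.hi_smul_of_pos (hC : IsProjCone C) (y : V) (hc : 0 < c) :
    hi C e (c • y) = c * hi C e y := by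
  rw [hi, hC.slice_smul y hc.ne', Real.sSup_smul_of_nonneg hc.le, smul_eq_mul, hi]

theorem IsProjCone.lo_smul_of_neg (hC : IsProjCone C) (y : V) (hc : c < 0) :
    lo C e (c • y) = c * hi C e y := by
  rw [lo, hC.slice_smul y hc.ne, Real.sInf_smul_of_nonpos hc.le, smul_eq_mul, hi]

theorem IsProjCone.hi_smul_of_neg (hC : IsProjCone C) (y : V) (hc : c < 0) :
    hi C e (c • y) = c * lo C e y := by
  rw [hi, hC.slice_smul y hc.ne, Real.sSup_smul_of_nonpos hc.le, smul_eq_mul, lo]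

end SliceScaling

/-- The midpoint of a slice. -/
noncomputable def mid {V : Type*} [AddCommGroup V] [Module ℝ V] (C : Set V) (e y : V) : ℝ :=
  (lo C e y + hi C e y) / 2

namespace QuadricFamily

variable {V : Type*} [NormedAddCommGroup V] [NormedSpace ℝ V] {P : QuadricFamily V}

/-- The largest parameter `r` with `0 ≤ discr (y + r • e)`. It is a zero of `discr` if
`discr e < 0`. -/
noncomputable def lastZero (P : QuadricFamily V) (e : V) : V → ℝ := hi {x | 0 ≤ P.discr x} e

theorem isProjCone_discr_nonneg [FiniteDimensional ℝ V] (P : QuadricFamily V) :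
    IsProjCone {x | 0 ≤ P.discr x} where
  isClosed := isClosed_le continuous_const P.continuous_discr
  smul_mem c x (hx : 0 ≤ P.discr x) := by
    rw [mem_ofPred_eq, P.discr_smul]
    positivity

/-- `e` is a viewpoint from which `C` is visible in every direction: each line through `[e]` meets
`C` in a nondegenerate interval. -/
structure IsBandCenter (P : QuadricFamily V) (C C' : Set V) (e : V) : Prop
    extends P.IsViewpoint C C' e where
  lo_lt_hi : ∀ y, (∀ r : ℝ, y + r • e ≠ 0) → lo C e y < hi C e y

theorem IsViewpoint.isBandCenter {P : QuadricFamily (Fin 3 → ℝ)} {C C' : Set (Fin 3 → ℝ)}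
    {e : Fin 3 → ℝ} (h : P.IsViewpoint C C' e) (hP : P.Smooth)
    (hC : ∀ y, (∀ r : ℝ, y + r • e ≠ 0) → (slice C e y).Nonempty) : P.IsBandCenter C C' e where
  toIsViewpoint := h
  lo_lt_hi y hy := by
    have hys : y ∈ shadow C e := ⟨hC y hy, hy⟩
    refine (h.lo_le_hi hys).lt_of_ne fun heq => ?_
    have hlin : LinearIndependent ℝ ![y, e] := by
      refine LinearIndependent.pair_symm_iff.mp
        ((LinearIndependent.pair_iff' h.ne_zero).mpr fun r hr => hy (-r) ?_)
      rw [← hr, neg_smul, add_neg_cancel]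
    obtain ⟨B, rfl, rfl⟩ := exists_basis_of_linearIndependent hlin
    have hspan : ∀ w, w ∈ Submodule.span ℝ {B 1, B 0, B 2} := fun w => by
      simpa [insert_comm] using mem_span_chart B 0 w
    have hκ := h.discrDeriv_ne_zero hP hys heq hspan
    obtain ⟨s, hs, hempty⟩ := ((frequently_mul_pos hκ).and_eventually
      (h.eventually_not_nonempty_slice hys heq hκ)).exists
    refine hempty hs (hC _ fun r hr => ?_)
    simpa using congrArg (B.coord 1) hr

namespace IsViewpoint

variable {C C' : Set V} {e y : V} {c r : ℝ}

theorem exists_lo_bound (h : P.IsViewpoint C C' e) : ∃ M : ℝ, ∀ y, |lo C e y| ≤ M * ‖y‖ := by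
  obtain ⟨M, hM, hb⟩ := h.exists_slice_bound
  refine ⟨M, fun y => ?_⟩
  rcases (slice C e y).eq_empty_or_nonempty with hy | hy
  · rw [lo, hy, Real.sInf_empty, abs_zero]
    positivity
  · exact hb y _ ((h.isCompact_slice y).sInf_mem hy)

theorem lo_zero (h : P.IsViewpoint C C' e) : lo C e 0 = 0 := by
  obtain ⟨M, hM⟩ := h.exists_lo_bound
  simpa using hM 0

theorem hi_zero (h : P.IsViewpoint C C' e) : hi C e 0 = 0 := by
  simpa [lo_neg] using h.neg.lo_zero

theorem continuousAt_lo_zero (h : P.IsViewpoint C C' e) : ContinuousAt (lo C e) 0 := by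
  obtain ⟨M, hM⟩ := h.exists_lo_bound
  have hlim : Tendsto (fun y : V => M * ‖y‖) (𝓝 0) (𝓝 0) := by
    have hcont : Continuous fun y : V => M * ‖y‖ := by fun_prop
    simpa using hcont.tendsto 0
  rw [ContinuousAt, h.lo_zero]
  exact squeeze_zero_norm hM hlim

theorem continuousAt_hi_zero (h : P.IsViewpoint C C' e) : ContinuousAt (hi C e) 0 := by
  have hneg := h.neg.continuousAt_lo_zero.neg
  simpa only [funext (lo_neg C e), Pi.neg_def, neg_neg] using hneg

theorem mid_smul (h : P.IsViewpoint C C' e) (c : ℝ) (y : V) :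
    mid C e (c • y) = c * mid C e y := by
  rcases lt_trichotomy c 0 with hc | rfl | hc
  · rw [mid, h.left.lo_smul_of_neg y hc, h.left.hi_smul_of_neg y hc, mid]
    ring
  · rw [mid, zero_smul, h.lo_zero, h.hi_zero]
    ring
  · rw [mid, h.left.lo_smul_of_pos y hc, h.left.hi_smul_of_pos y hc, mid]
    ring

end IsViewpoint

namespace IsBandCenter

variable {C C' : Set V} {e y : V} {r : ℝ}

theorem mem_shadow (h : P.IsBandCenter C C' e) (hy : ∀ r : ℝ, y + r • e ≠ 0) :
    y ∈ shadow C e := by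
  refine ⟨nonempty_iff_ne_empty.mpr fun hempty => (h.lo_lt_hi y hy).ne ?_, hy⟩
  rw [lo, hi, hempty, Real.sInf_empty, Real.sSup_empty]

theorem mid_mem_Ioo (h : P.IsBandCenter C C' e) (hy : ∀ r : ℝ, y + r • e ≠ 0) :
    mid C e y ∈ Ioo (lo C e y) (hi C e y) := by
  have := h.lo_lt_hi y hy
  constructor <;> rw [mid] <;> linarith

variable [FiniteDimensional ℝ V]

theorem exists_discr_eq_mul (h : P.IsBandCenter C C' e) (hy : ∀ r : ℝ, y + r • e ≠ 0) :
    ∃ k < lo C e y, hi C e y < P.lastZero e y ∧ ∀ r, P.discr (y + r • e) =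
      P.discr e * ((r - k) * (r - lo C e y) * (r - hi C e y) * (r - P.lastZero e y)) := by
  have hlt := h.lo_lt_hi y hy
  obtain ⟨k₁, hk₁, k₂, hk₂, hf⟩ := h.toIsViewpoint.exists_discr_eq_mul (h.mem_shadow hy) hlt
  have hlast : P.lastZero e y = k₂ := by
    refine IsGreatest.csSup_eq ⟨?_, fun r (hr : 0 ≤ P.discr (y + r • e)) => ?_⟩
    · change 0 ≤ P.discr (y + k₂ • e)
      rw [hf, sub_self, mul_zero, mul_zero]
    · by_contra! hr'
      refine hr.not_gt (hf r ▸ mul_neg_of_neg_of_pos h.discr_neg ?_)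
      have hhi := hk₂.trans hr'
      exact mul_pos (mul_pos (mul_pos (sub_pos.mpr (hk₁.trans (hlt.trans hhi)))
        (sub_pos.mpr (hlt.trans hhi))) (sub_pos.mpr hhi)) (sub_pos.mpr hr')
  exact ⟨k₁, hk₁, hlast ▸ hk₂, hlast ▸ hf⟩

theorem hi_lt_lastZero (h : P.IsBandCenter C C' e) (hy : ∀ r : ℝ, y + r • e ≠ 0) :
    hi C e y < P.lastZero e y := by
  obtain ⟨-, -, hlt, -⟩ := h.exists_discr_eq_mul hy
  exact hlt

theorem exists_pos_discr_eq_mul (h : P.IsBandCenter C C' e) (hy : ∀ r : ℝ, y + r • e ≠ 0)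
    (hr : lo C e y < r) :
    ∃ κ > 0, P.discr (y + r • e) = κ * ((r - hi C e y) * (P.lastZero e y - r)) := by
  obtain ⟨k, hk, -, hf⟩ := h.exists_discr_eq_mul hy
  refine ⟨-P.discr e * ((r - k) * (r - lo C e y)), ?_, by rw [hf]; ring⟩
  exact mul_pos (neg_pos.mpr h.discr_neg)
    (mul_pos (sub_pos.mpr (hk.trans hr)) (sub_pos.mpr hr))

theorem discr_eq_zero_iff_of_lo_lt (h : P.IsBandCenter C C' e) (hy : ∀ r : ℝ, y + r • e ≠ 0)
    (hr : lo C e y < r) : P.discr (y + r • e) = 0 ↔ r = hi C e y ∨ r = P.lastZero e y := by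
  obtain ⟨κ, hκ, hf⟩ := h.exists_pos_discr_eq_mul hy hr
  rw [hf, mul_eq_zero_iff_left hκ.ne', mul_eq_zero, sub_eq_zero, sub_eq_zero, eq_comm (b := r)]

theorem lt_lastZero_iff (h : P.IsBandCenter C C' e) (hy : ∀ r : ℝ, y + r • e ≠ 0)
    (hr : hi C e y < r) : r < P.lastZero e y ↔ 0 < P.discr (y + r • e) := by
  obtain ⟨κ, hκ, hf⟩ := h.exists_pos_discr_eq_mul hy ((h.lo_lt_hi y hy).trans hr)
  rw [hf, mul_pos_iff_of_pos_left hκ, mul_pos_iff_of_pos_left (sub_pos.mpr hr), sub_pos]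

theorem lastZero_lt_iff (h : P.IsBandCenter C C' e) (hy : ∀ r : ℝ, y + r • e ≠ 0)
    (hr : hi C e y < r) : P.lastZero e y < r ↔ P.discr (y + r • e) < 0 := by
  obtain ⟨κ, hκ, hf⟩ := h.exists_pos_discr_eq_mul hy ((h.lo_lt_hi y hy).trans hr)
  rw [hf, ← neg_pos, ← mul_neg, mul_pos_iff_of_pos_left hκ, ← mul_neg,
    mul_pos_iff_of_pos_left (sub_pos.mpr hr), neg_sub, sub_pos]

theorem continuousOn_lastZero (h : P.IsBandCenter C C' e) :
    ContinuousOn (P.lastZero e) {y | ∀ r : ℝ, y + r • e ≠ 0} := by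
  intro y (hy : ∀ r : ℝ, y + r • e ≠ 0)
  have hdiscr (r : ℝ) : Continuous fun y => P.discr (y + r • e) := by fun_prop
  have hhi {r : ℝ} (hr : hi C e y < r) :
      ∀ᶠ y' in 𝓝[{y | ∀ r : ℝ, y + r • e ≠ 0}] y, hi C e y' < r :=
    (h.continuousOn_hi.mono (fun _ => h.mem_shadow) y hy).eventually_lt_const hr
  refine tendsto_order.mpr ⟨fun a ha => ?_, fun b hb => ?_⟩
  · obtain ⟨r, hr, hr'⟩ := exists_between (max_lt ha (h.hi_lt_lastZero hy))
    have hhr := (le_max_right _ _).trans_lt hr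
    filter_upwards [hhi hhr, self_mem_nhdsWithin, ((hdiscr r).continuousWithinAt.eventually_const_lt
      ((h.lt_lastZero_iff hy hhr).mp hr'))] with y' hy1 hy2 hy3
    exact ((le_max_left _ _).trans_lt hr).trans ((h.lt_lastZero_iff hy2 hy1).mpr hy3)
  · have hhb := (h.hi_lt_lastZero hy).trans hb
    filter_upwards [hhi hhb, self_mem_nhdsWithin, ((hdiscr b).continuousWithinAt.eventually_lt_const
      ((h.lastZero_lt_iff hy hhb).mp hb))] with y' hy1 hy2 hy3
    exact (h.lastZero_lt_iff hy2 hy1).mpr hy3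

end IsBandCenter

section BandChart

variable {E : Type*} [NormedAddCommGroup E] [NormedSpace ℝ E] {L : E →L[ℝ] V}
  {C C' : Set V} {e : V} {z : E}

/-- `L` embeds `E` as a complement of the line spanned by `e`. -/
def IsTransversal (L : E →L[ℝ] V) (e : V) : Prop :=
  Function.Bijective fun p : E × ℝ => L p.1 + p.2 • e

theorem IsTransversal.add_smul_ne_zero (hL : IsTransversal L e) (hz : z ≠ 0) (r : ℝ) :
    L z + r • e ≠ 0 := by
  intro h0
  have heq : (z, r) = 0 := hL.1 (by simpa using h0)
  exact hz (congrArg Prod.fst heq)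

/-- Homogeneous coordinates of an affine chart around `[e]`: the midpoints of the slices of `C` are
its points at infinity. -/
noncomputable def bandVec (C : Set V) (e : V) (L : E →L[ℝ] V) (z : E) : V :=
  L z + (1 + mid C e (L z)) • e

namespace IsBandCenter

theorem bandVec_zero (h : P.IsBandCenter C C' e) (L : E →L[ℝ] V) : bandVec C e L 0 = e := by
  rw [bandVec, mid, map_zero, h.lo_zero, h.hi_zero]
  simp

theorem bandVec_ne_zero (h : P.IsBandCenter C C' e) (hL : IsTransversal L e) (z : E) :
    bandVec C e L z ≠ 0 := by
  rcases eq_or_ne z 0 with rfl | hz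
  · rw [h.bandVec_zero]
    exact h.ne_zero
  · exact hL.add_smul_ne_zero hz _

theorem eq_of_smul_bandVec_eq (h : P.IsBandCenter C C' e) (hL : IsTransversal L e) {x y : E}
    {c : ℝ} (hc : c • bandVec C e L y = bandVec C e L x) : x = y := by
  have heq : (c • y, c * (1 + mid C e (L y))) = (x, 1 + mid C e (L x)) := hL.1 (by
    simpa only [bandVec, smul_add, smul_smul, map_smul] using hc)
  obtain ⟨rfl, hmid⟩ := Prod.mk.inj heq
  rw [map_smul, h.mid_smul] at hmid
  rw [show c = 1 by linarith, one_smul]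

variable [FiniteDimensional ℝ V]

theorem continuousOn_lo_comp (h : P.IsBandCenter C C' e) (hL : IsTransversal L e) :
    ContinuousOn (fun z => lo C e (L z)) {0}ᶜ :=
  h.continuousOn_lo.comp L.continuous.continuousOn
    fun _ hz => h.mem_shadow (hL.add_smul_ne_zero hz)

theorem continuousOn_hi_comp (h : P.IsBandCenter C C' e) (hL : IsTransversal L e) :
    ContinuousOn (fun z => hi C e (L z)) {0}ᶜ :=
  h.continuousOn_hi.comp L.continuous.continuousOn
    fun _ hz => h.mem_shadow (hL.add_smul_ne_zero hz)

theorem continuous_mid (h : P.IsBandCenter C C' e) (hL : IsTransversal L e) :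
    Continuous fun z => mid C e (L z) := by
  refine continuous_iff_continuousAt.mpr fun z => ContinuousAt.div_const ?_ 2
  rcases eq_or_ne z 0 with rfl | hz
  · have hlim := h.continuousAt_lo_zero.add h.continuousAt_hi_zero
    rw [← L.map_zero] at hlim
    exact hlim.comp L.continuous.continuousAt
  · exact ((h.continuousOn_lo_comp hL).add (h.continuousOn_hi_comp hL)).continuousAt
      (isOpen_compl_singleton.mem_nhds hz)

theorem continuous_bandVec (h : P.IsBandCenter C C' e) (hL : IsTransversal L e) :
    Continuous (bandVec C e L) := by
  have hmid := h.continuous_mid hL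
  unfold bandVec
  fun_prop

theorem isRadialGauge_hi (h : P.IsBandCenter C C' e) (hL : IsTransversal L e) :
    IsRadialGauge fun z => hi C e (L z) - mid C e (L z) where
  continuousOn := (h.continuousOn_hi_comp hL).sub (h.continuous_mid hL).continuousOn
  pos z hz := sub_pos.mpr (h.mid_mem_Ioo (hL.add_smul_ne_zero hz)).2
  smul c hc z := by rw [map_smul, h.left.hi_smul_of_pos _ hc, h.mid_smul, mul_sub]

theorem isRadialGauge_lastZero (h : P.IsBandCenter C C' e) (hL : IsTransversal L e) :
    IsRadialGauge fun z => P.lastZero e (L z) - mid C e (L z) where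
  continuousOn := (h.continuousOn_lastZero.comp L.continuous.continuousOn
    fun _ hz => hL.add_smul_ne_zero hz).sub (h.continuous_mid hL).continuousOn
  pos z hz := by
    have hy := hL.add_smul_ne_zero hz
    exact sub_pos.mpr ((h.mid_mem_Ioo hy).2.trans (h.hi_lt_lastZero hy))
  smul c hc z := by
    rw [map_smul, lastZero, P.isProjCone_discr_nonneg.hi_smul_of_pos _ hc, h.mid_smul, mul_sub]

theorem discr_bandVec_eq_zero_iff (h : P.IsBandCenter C C' e) (hL : IsTransversal L e) (z : E) :
    P.discr (bandVec C e L z) = 0 ↔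
      hi C e (L z) - mid C e (L z) = 1 ∨ P.lastZero e (L z) - mid C e (L z) = 1 := by
  rcases eq_or_ne z 0 with rfl | hz
  · rw [h.bandVec_zero L, (h.isRadialGauge_hi hL).map_zero, (h.isRadialGauge_lastZero hL).map_zero]
    simpa using h.discr_neg.ne
  · have hy := hL.add_smul_ne_zero hz
    rw [bandVec, h.discr_eq_zero_iff_of_lo_lt hy (by linarith [(h.mid_mem_Ioo hy).1]),
      sub_eq_iff_eq_add, sub_eq_iff_eq_add, eq_comm, eq_comm (b := P.lastZero e (L z))]

theorem exists_bandVec_eq_smul (h : P.IsBandCenter C C' e) (hL : IsTransversal L e) {x : V}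
    (hx : x ≠ 0) (hx0 : P.discr x = 0) : ∃ (z : E) (c : ℝ), bandVec C e L z = c • x := by
  obtain ⟨⟨w, r⟩, rfl⟩ := hL.2 x
  simp only at hx hx0 ⊢
  have hw : w ≠ 0 := by
    rintro rfl
    rw [map_zero, zero_add] at hx hx0
    rw [P.discr_smul, mul_eq_zero_iff_right h.discr_neg.ne, pow_eq_zero_iff four_ne_zero] at hx0
    exact hx (by rw [hx0, zero_smul])
  have hy := hL.add_smul_ne_zero hw
  have hr : r - mid C e (L w) ≠ 0 := fun hr => by
    rw [sub_eq_zero.mp hr] at hx0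
    exact (h.discr_neg_of_mem_Ioo (h.mem_shadow hy) (h.mid_mem_Ioo hy)).ne hx0
  refine ⟨(r - mid C e (L w))⁻¹ • w, (r - mid C e (L w))⁻¹, ?_⟩
  rw [bandVec, map_smul, h.mid_smul, smul_add, smul_smul]
  congr 2
  field_simp
  ring

end IsBandCenter

end BandChart

end QuadricFamily

theorem IsRadialGauge.exists_disc {k : EuclideanSpace ℝ (Fin 2) → ℝ} (hk : IsRadialGauge k)
    {Ψ : EuclideanSpace ℝ (Fin 2) → RP2} (hΨ : Continuous Ψ) (hinj : Function.Injective Ψ) :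
    ∃ φ : ClosedDisc → RP2, IsEmbedding φ ∧ range φ = Ψ '' {z | k z ≤ 1} ∧
      discInterior φ = Ψ '' {z | k z < 1} ∧ discBoundary φ = Ψ '' {z | k z = 1} := by
  set φ : ClosedDisc → RP2 := fun x => Ψ (radialMap k x.1)
  have himage (p : ℝ → Prop) (hp : ∀ r, p r → r ≤ 1) :
      φ '' {x | p ‖x.1‖} = Ψ '' {z | p (k z)} := by
    apply Subset.antisymm
    · rintro _ ⟨x, hx, rfl⟩
      exact mem_image_of_mem Ψ (by rwa [mem_ofPred_eq, hk.apply_radialMap])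
    · rintro _ ⟨z, hz, rfl⟩
      obtain ⟨x, rfl⟩ := hk.radialMap_surjective z
      rw [mem_ofPred_eq, hk.apply_radialMap] at hz
      exact ⟨⟨x, mem_closedBall_zero_iff.mpr (hp _ hz)⟩, hz, rfl⟩
  refine ⟨φ, RP2.isEmbedding_of_injective
    (hΨ.comp (hk.continuous_radialMap.comp continuous_subtype_val))
    (hinj.comp (hk.radialMap_injective.comp Subtype.val_injective)), ?_,
    himage (· < 1) fun _ => le_of_lt, himage (· = 1) fun _ => le_of_eq⟩
  rw [← himage (· ≤ 1) fun _ => id, ← image_univ]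
  congr 1
  exact (eq_univ_of_forall fun x => mem_closedBall_zero_iff.mp x.2).symm

theorem QuadricFamily.exists_isTransversal {e : Fin 3 → ℝ} (he : e ≠ 0) :
    ∃ L : EuclideanSpace ℝ (Fin 2) →L[ℝ] (Fin 3 → ℝ), IsTransversal L e := by
  obtain ⟨v, hv⟩ := exists_linearIndependent_pair_of_one_lt_finrank (R := ℝ)
    (by simp : 1 < Module.finrank ℝ (Fin 3 → ℝ)) he
  obtain ⟨B, -, rfl⟩ := exists_basis_of_linearIndependent (LinearIndependent.pair_symm_iff.mp hv)
  refine ⟨(EuclideanSpace.proj 0).smulRight (B 0) + (EuclideanSpace.proj 1).smulRight (B 1),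
    fun p q hpq => ?_, fun x => ⟨(!₂[B.coord 0 x, B.coord 1 x], B.coord 2 x), ?_⟩⟩
  · have hcoord (i) := congrArg (B.coord i) hpq
    refine Prod.ext (PiLp.ext fun i => ?_) (by simpa using hcoord 2)
    fin_cases i
    · simpa using hcoord 0
    · simpa using hcoord 1
  · simpa using (eq_sum_coord B x).symm

/- In the affine chart given by `bandVec`, the curve `discr = 0` is the union of the boundaries of
two star-shaped domains. -/
theorem QuadricFamily.IsBandCenter.isTwoNestedOvals {P : QuadricFamily (Fin 3 → ℝ)}
    {C C' : Set (Fin 3 → ℝ)} {e : Fin 3 → ℝ} (h : P.IsBandCenter C C' e) :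
    IsTwoNestedOvals (projSet {x | P.discr x = 0}) := by
  obtain ⟨L, hL⟩ := exists_isTransversal h.ne_zero
  set Ψ : EuclideanSpace ℝ (Fin 2) → RP2 :=
    fun z => Projectivization.mk ℝ (bandVec C e L z) (h.bandVec_ne_zero hL z)
  have hcont : Continuous Ψ := RP2.continuous_mk (h.continuous_bandVec hL) _
  have hinj : Function.Injective Ψ := fun x y hxy => by
    obtain ⟨c, hc⟩ := (Projectivization.mk_eq_mk_iff' ℝ _ _ _ _).mp hxy
    exact h.eq_of_smul_bandVec_eq hL hc
  obtain ⟨φ, hφ, hrange, -, hφb⟩ := (h.isRadialGauge_lastZero hL).exists_disc hcont hinj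
  obtain ⟨ψ, hψ, -, hint, hψb⟩ := (h.isRadialGauge_hi hL).exists_disc hcont hinj
  refine ⟨φ, ψ, hφ, hψ, ?_, ?_⟩
  · rw [hrange, hint]
    refine image_mono fun z hz => ?_
    rw [mem_ofPred_eq] at hz ⊢
    rcases eq_or_ne z 0 with rfl | hz0
    · exact (h.isRadialGauge_hi hL).map_zero.trans_lt one_pos
    · exact (sub_lt_sub_right (h.hi_lt_lastZero (hL.add_smul_ne_zero hz0)) _).trans_le hz
  · rw [hφb, hψb, ← image_union]
    ext p
    constructor
    · intro (hp : P.discr p.rep = 0)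
      obtain ⟨z, c, hz⟩ := h.exists_bandVec_eq_smul hL p.rep_nonzero hp
      refine ⟨z, ((h.discr_bandVec_eq_zero_iff hL z).mp ?_).symm, ?_⟩
      · rw [hz, P.discr_smul, hp, mul_zero]
      · rw [← p.mk_rep]
        exact (Projectivization.mk_eq_mk_iff' ℝ _ _ _ _).mpr ⟨c, hz.symm⟩
    · rintro ⟨z, hz, rfl⟩
      exact (P.isProjCone_discr_eq_zero.mk_mem_projSet _).mpr
        ((h.discr_bandVec_eq_zero_iff hL z).mpr hz.symm)

section PolarForm

variable {σ : Type*} [Fintype σ] [DecidableEq σ] {Q : MvPolynomial σ ℝ}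

/-- The symmetric bilinear form `B` with `Q(x) = B(x, x)`, for a quadratic form `Q`: its Gram matrix
is half of the Hessian of `Q`. -/
noncomputable def polarForm (Q : MvPolynomial σ ℝ) : LinearMap.BilinForm ℝ (σ → ℝ) :=
  Matrix.toBilin' (Matrix.of fun i j =>
    (MvPolynomial.pderiv i (MvPolynomial.pderiv j Q)).coeff 0 / 2)

theorem isSymm_polarForm (Q : MvPolynomial σ ℝ) : (polarForm Q).IsSymm := by
  rw [polarForm, Matrix.isSymm_toBilin'_iff_isSymm]
  refine Matrix.IsSymm.ext fun i j => ?_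
  rw [Matrix.of_apply, Matrix.of_apply]
  congr 1
  rcases eq_or_ne i j with rfl | hij
  · rfl
  · simp only [MvPolynomial.coeff_pderiv, zero_add, Finsupp.single_eq_of_ne hij,
      Finsupp.single_eq_of_ne hij.symm, add_comm (Finsupp.single j 1), Finsupp.coe_zero,
      Pi.zero_apply]

theorem two_mul_polarForm_single (hQ : Q.IsHomogeneous 2) (x : σ → ℝ) (i : σ) :
    2 * polarForm Q x (Pi.single i 1) = MvPolynomial.eval x (MvPolynomial.pderiv i Q) := by
  have hconst (j : σ) : MvPolynomial.pderiv j (MvPolynomial.pderiv i Q) =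
      MvPolynomial.C ((MvPolynomial.pderiv j (MvPolynomial.pderiv i Q)).coeff 0) :=
    MvPolynomial.totalDegree_eq_zero_iff_eq_C.mp <|
      (MvPolynomial.totalDegree_zero_iff_isHomogeneous _).mpr hQ.pderiv.pderiv
  have euler := congrArg (MvPolynomial.eval x) (hQ.pderiv (i := i)).sum_X_mul_pderiv
  rw [map_sum, Nat.add_one_sub_one, one_smul] at euler
  rw [← euler, polarForm, Matrix.toBilin'_apply, Finset.mul_sum]
  refine Finset.sum_congr rfl fun j _ => ?_
  rw [hconst j]
  simp only [Matrix.of_apply, Pi.single_apply, mul_ite, mul_one, mul_zero, Finset.sum_ite_eq',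
    Finset.mem_univ, if_true, map_mul, MvPolynomial.eval_X, MvPolynomial.eval_C]
  ring

theorem polarForm_self (hQ : Q.IsHomogeneous 2) (x : σ → ℝ) :
    polarForm Q x x = MvPolynomial.eval x Q := by
  have euler := congrArg (MvPolynomial.eval x) hQ.sum_X_mul_pderiv
  simp only [map_sum, map_mul, MvPolynomial.eval_X, ← two_mul_polarForm_single hQ, nsmul_eq_mul,
    Nat.cast_ofNat, map_ofNat, mul_left_comm _ (2 : ℝ), ← Finset.mul_sum] at euler
  refine Eq.trans ?_ (mul_left_cancel₀ two_ne_zero euler)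
  nth_rw 2 [pi_eq_sum_univ' x]
  simp only [map_sum, map_smul, smul_eq_mul]

end PolarForm

/-! ### The ovals of the discriminant curve -/

namespace ConePartition

variable {ι : Type*} [Finite ι] {P : QuadricFamily (Fin 3 → ℝ)} {C : ι → Set (Fin 3 → ℝ)} {i j : ι}

theorem isOvalIn_or_isViewpoint (h : ConePartition {x | P.discr x ≤ 0} C) (hP : P.Smooth)
    (hconn : ∀ i, IsConnected (projSet (C i))) (hij : i ≠ j) :
    P.IsOvalIn (C i) ∨ ∃ e ∈ C j, P.IsViewpoint (C i) (⋃ k ∈ ({i}ᶜ : Set ι), C k) e ∧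
      ∀ y, (∀ r : ℝ, y + r • e ≠ 0) → (slice (C i) e y).Nonempty := by
  obtain ⟨e, he, hneg⟩ := hP.exists_discr_neg (h.split_singleton j) (h.nontrivial j)
  have hview : P.IsViewpoint (C i) (⋃ k ∈ ({i}ᶜ : Set ι), C k) e :=
    ⟨h.split_singleton i, mem_biUnion_compl_singleton hij he, hneg⟩
  refine or_iff_not_imp_right.mpr fun hall => ?_
  push Not at hall
  obtain ⟨v, hv, hv_empty⟩ := hall e he hview
  exact hview.isOvalIn hP (hconn i) hv (not_nonempty_iff_eq_empty.mpr hv_empty)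

theorem isNonNestedOvals (h : ConePartition {x | P.discr x ≤ 0} C)
    (hoval : ∀ i, P.IsOvalIn (C i)) :
    IsNonNestedOvals (Nat.card ι) (projSet {x | P.discr x = 0}) := by
  choose φ hφ hrange hboundary using hoval
  have hcover : projSet {x | P.discr x = 0} ⊆ ⋃ i, projSet (C i) := fun p hp => by
    have hmem : p.rep ∈ ⋃ i, C i := h.iUnion ▸ le_of_eq hp
    obtain ⟨i, hi⟩ := mem_iUnion.mp hmem
    exact mem_iUnion.mpr ⟨i, hi⟩
  let f := (Finite.equivFin ι).symm
  refine ⟨fun k => φ (f k), fun k => hφ (f k), fun k l hkl => ?_, ?_⟩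
  · refine disjoint_left.mpr fun p hp hp' => p.rep_nonzero ?_
    exact h.eq_zero _ _ (f.injective.ne hkl) _ (hrange _ hp) (hrange _ hp')
  · rw [f.surjective.iUnion_comp fun i => discBoundary (φ i)]
    simp only [hboundary, ← iUnion_inter]
    exact (inter_eq_right.mpr hcover).symm

theorem isNonNestedOvals_or_isTwoNestedOvals (h : ConePartition {x | P.discr x ≤ 0} C)
    (hP : P.Smooth) (hconn : ∀ i, IsConnected (projSet (C i))) (hι : Nat.card ι = 2) :
    IsNonNestedOvals 2 (projSet {x | P.discr x = 0}) ∨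
      IsTwoNestedOvals (projSet {x | P.discr x = 0}) := by
  by_cases hoval : ∀ i, P.IsOvalIn (C i)
  · exact Or.inl (hι ▸ h.isNonNestedOvals hoval)
  · obtain ⟨i, hi⟩ := not_forall.mp hoval
    have : Nontrivial ι := Finite.one_lt_card_iff_nontrivial.mp (hι ▸ one_lt_two)
    obtain ⟨j, hji⟩ := exists_ne i
    obtain ⟨e, -, hview, hall⟩ :=
      (h.isOvalIn_or_isViewpoint hP hconn hji.symm).resolve_left hi
    exact Or.inr (hview.isBandCenter hP hall).isTwoNestedOvals

/- If `e` in the piece `C j` had every line through it meet `C i`, then a line through `e` and a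
point of a third piece `C k` would meet `C i ∪ C k` in an interval, which cannot be. -/
theorem not_forall_nonempty_slice (h : ConePartition {x | P.discr x ≤ 0} C) {k : ι} (hij : i ≠ j)
    (hik : i ≠ k) (hjk : j ≠ k) {e : Fin 3 → ℝ} (he : e ∈ C j) (hneg : P.discr e < 0) :
    ¬ ∀ y, (∀ r : ℝ, y + r • e ≠ 0) → (slice (C i) e y).Nonempty := by
  intro hall
  obtain ⟨x, hx, hx0⟩ := h.nontrivial k
  have hoff (r : ℝ) : x + r • e ≠ 0 := fun h0 => by
    refine hx0 (h.eq_zero j k hjk x ?_ hx)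
    rw [eq_neg_of_add_eq_zero_left h0, ← neg_smul]
    exact (h.isProjCone j).smul_mem _ _ he
  obtain ⟨r, hr⟩ := hall x hoff
  have hview : P.IsViewpoint (⋃ l ∈ ({i, k} : Set ι), C l) (⋃ l ∈ ({i, k}ᶜ : Set ι), C l) e :=
    ⟨h.split {i, k}, mem_biUnion (by simp [hij.symm, hjk]) he, hneg⟩
  have hr' : r ∈ slice (⋃ l ∈ ({i, k} : Set ι), C l) e x :=
    mem_biUnion (mem_insert i {k}) hr
  have h0 : (0 : ℝ) ∈ slice (⋃ l ∈ ({i, k} : Set ι), C l) e x :=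
    mem_biUnion (mem_insert_of_mem i rfl) (by simpa only [zero_smul, add_zero] using hx)
  have hpre : IsPreconnected ((fun s : ℝ => x + s • e) ''
      slice (⋃ l ∈ ({i, k} : Set ι), C l) e x) := by
    rw [hview.slice_eq_Icc ⟨⟨r, hr'⟩, hoff⟩]
    exact isPreconnected_Icc.image _ (by fun_prop)
  refine (h.split_singleton i).notMem_right_of_isPreconnected hpre ?_ ?_ ⟨r, hr', rfl⟩ hr
    ⟨0, h0, rfl⟩ (mem_biUnion_compl_singleton hik (by simpa using hx))
  · rintro _ ⟨s, hs, rfl⟩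
    exact hview.subset_left hs
  · rintro ⟨s, -, hs⟩
    exact hoff s hs

theorem isNonNestedOvals_of_two_lt (h : ConePartition {x | P.discr x ≤ 0} C) (hP : P.Smooth)
    (hconn : ∀ i, IsConnected (projSet (C i))) (hι : 2 < Nat.card ι) :
    IsNonNestedOvals (Nat.card ι) (projSet {x | P.discr x = 0}) := by
  refine h.isNonNestedOvals fun i => ?_
  have hcard : 3 ≤ Cardinal.mk ι := by
    rw [← Nat.cast_card]
    exact_mod_cast hι
  obtain ⟨j, hj, -⟩ := Cardinal.exists_ne_ne_of_three_le hcard i i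
  obtain ⟨k, hk, hkj⟩ := Cardinal.exists_ne_ne_of_three_le hcard i j
  refine (h.isOvalIn_or_isViewpoint hP hconn hj.symm).resolve_right ?_
  rintro ⟨e, he, hview, hall⟩
  exact h.not_forall_nonempty_slice hj.symm hk.symm hkj.symm he hview.discr_neg hall

end ConePartition

theorem QuadricFamily.base_eq_of_conePartition {ι V : Type*} [NormedAddCommGroup V]
    [NormedSpace ℝ V] [FiniteDimensional ℝ V] {P : QuadricFamily V} [Finite ι] [Nontrivial ι]
    {C : ι → Set V} (h : ConePartition P.base C) : P.base = {x | P.discr x ≤ 0} := by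
  obtain ⟨i, j, hij⟩ := exists_pair_ne ι
  obtain ⟨x, hx, hx0⟩ := h.nontrivial j
  obtain ⟨τ, hτ⟩ := exists_negDef (h.split_singleton i) (h.nontrivial i)
    ⟨x, mem_biUnion_compl_singleton hij hx, hx0⟩
  exact hτ.base_eq

/-! ### The double cover -/

namespace QuadricFamily

open MvPolynomial

variable {P : QuadricFamily (Fin 3 → ℝ)} {Q₁ Q₂ Q₃ : MvPolynomial (Fin 3) ℝ}

/-- The bilinear forms of the family `P` polarize the quadratic forms `Q₁`, `Q₂`, `Q₃`. -/
structure IsPolarization (P : QuadricFamily (Fin 3 → ℝ)) (Q₁ Q₂ Q₃ : MvPolynomial (Fin 3) ℝ) :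
    Prop where
  eval₁ : ∀ x, eval x Q₁ = P.B₁ x x
  eval₂ : ∀ x, eval x Q₂ = P.B₂ x x
  eval₃ : ∀ x, eval x Q₃ = P.B₃ x x

theorem IsPolarization.eval_eq_bilin (h : P.IsPolarization Q₁ Q₂ Q₃) (t : Fin 2 → ℝ)
    (x : Fin 3 → ℝ) :
    t 0 ^ 2 * eval x Q₁ + 2 * t 0 * t 1 * eval x Q₂ + t 1 ^ 2 * eval x Q₃ = P.bilin t x x := by
  rw [h.eval₁, h.eval₂, h.eval₃, bilin_apply]

theorem IsPolarization.eval_discrForm (h : P.IsPolarization Q₁ Q₂ Q₃) (x : Fin 3 → ℝ) :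
    eval x (discrForm Q₁ Q₂ Q₃) = P.discr x := by
  rw [discrForm, map_sub, map_mul, map_pow, h.eval₁, h.eval₂, h.eval₃, discr]

theorem IsPolarization.realLocus_discrForm (h : P.IsPolarization Q₁ Q₂ Q₃) :
    realLocus (discrForm Q₁ Q₂ Q₃) = projSet {x | P.discr x = 0} := by
  simp only [realLocus, projSet, h.eval_discrForm, mem_ofPred_eq]

variable (Q₁ Q₂ Q₃) in
/-- The quadratic family spanned by three quadratic forms in three variables. -/
noncomputable def ofPolynomials : QuadricFamily (Fin 3 → ℝ) where
  B₁ := polarForm Q₁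
  B₂ := polarForm Q₂
  B₃ := polarForm Q₃
  symm₁ := isSymm_polarForm Q₁
  symm₂ := isSymm_polarForm Q₂
  symm₃ := isSymm_polarForm Q₃

theorem isPolarization_ofPolynomials (hQ₁ : Q₁.IsHomogeneous 2) (hQ₂ : Q₂.IsHomogeneous 2)
    (hQ₃ : Q₃.IsHomogeneous 2) : (ofPolynomials Q₁ Q₂ Q₃).IsPolarization Q₁ Q₂ Q₃ where
  eval₁ x := (polarForm_self hQ₁ x).symm
  eval₂ x := (polarForm_self hQ₂ x).symm
  eval₃ x := (polarForm_self hQ₃ x).symm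

theorem two_mul_discrDeriv_ofPolynomials (hQ₁ : Q₁.IsHomogeneous 2) (hQ₂ : Q₂.IsHomogeneous 2)
    (hQ₃ : Q₃.IsHomogeneous 2) (x : Fin 3 → ℝ) (i : Fin 3) :
    2 * (ofPolynomials Q₁ Q₂ Q₃).discrDeriv x (Pi.single i 1) =
      eval x (pderiv i (discrForm Q₁ Q₂ Q₃)) := by
  simp only [discrForm, map_sub, Derivation.leibniz, Derivation.leibniz_pow, smul_eq_mul, map_add,
    map_mul, nsmul_eq_mul, Nat.cast_ofNat, map_ofNat, pow_one, Nat.add_one_sub_one,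
    ← two_mul_polarForm_single hQ₁, ← two_mul_polarForm_single hQ₂,
    ← two_mul_polarForm_single hQ₃, ← polarForm_self hQ₁, ← polarForm_self hQ₂,
    ← polarForm_self hQ₃, discrDeriv, ofPolynomials]
  ring

theorem smooth_ofPolynomials (hQ₁ : Q₁.IsHomogeneous 2) (hQ₂ : Q₂.IsHomogeneous 2)
    (hQ₃ : Q₃.IsHomogeneous 2)
    (hΔ : ∀ p, p ≠ 0 → eval p (discrForm Q₁ Q₂ Q₃) = 0 →
      ∃ i, eval p (pderiv i (discrForm Q₁ Q₂ Q₃)) ≠ 0) :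
    (ofPolynomials Q₁ Q₂ Q₃).Smooth := by
  intro p hp h0
  obtain ⟨i, hi⟩ := hΔ p hp
    (((isPolarization_ofPolynomials hQ₁ hQ₂ hQ₃).eval_discrForm p).trans h0)
  rw [← two_mul_discrDeriv_ofPolynomials hQ₁ hQ₂ hQ₃] at hi
  exact ⟨_, right_ne_zero_of_mul hi⟩

end QuadricFamily

theorem IsSmoothPlaneCurve.exists_eval_pderiv_ne_zero {f : MvPolynomial (Fin 3) ℝ}
    (hf : IsSmoothPlaneCurve f) {p : Fin 3 → ℝ} (hp : p ≠ 0) (h0 : MvPolynomial.eval p f = 0) :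
    ∃ i, MvPolynomial.eval p (MvPolynomial.pderiv i f) ≠ 0 := by
  have haeval (g : MvPolynomial (Fin 3) ℝ) :
      MvPolynomial.aeval (fun i => (p i : ℂ)) g = (MvPolynomial.eval p g : ℂ) := by
    simpa [MvPolynomial.aeval_eq_eval, Function.comp_def] using
      MvPolynomial.aeval_algebraMap_apply ℂ p g
  obtain ⟨i, hi⟩ := hf (fun i => (p i : ℂ))
    (fun h => hp (funext fun i => Complex.ofReal_eq_zero.mp (congrFun h i)))
    (by rw [haeval, h0, Complex.ofReal_zero])
  rw [haeval] at hi
  exact ⟨i, Complex.ofReal_ne_zero.mp hi⟩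

section PuncturedNonneg

variable {W Y : Type*} [NormedAddCommGroup W] [NormedSpace ℝ W] [TopologicalSpace Y]

/-- The nonzero vectors on which the quadratic form of `β` is nonnegative. -/
def puncturedNonneg (β : LinearMap.BilinForm ℝ W) : Set W := {t | t ≠ 0 ∧ 0 ≤ β t t}

variable {β : LinearMap.BilinForm ℝ W} {f : puncturedNonneg β → Y}

theorem segment_subset_puncturedNonneg (hβ : β.IsSymm) {u w : W} (hu : u ≠ 0) (hu0 : β u u = 0)
    (hw : 0 ≤ β w w) (huw : 0 ≤ β u w) (hpar : ∀ c : ℝ, w ≠ c • u) :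
    segment ℝ u w ⊆ puncturedNonneg β := fun _ ht =>
  ⟨ne_of_mem_of_not_mem ht fun h0 =>
    let ⟨c, hc⟩ := exists_eq_smul_of_zero_mem_segment hu h0
    hpar c hc, bilinForm_nonneg_of_mem_segment hβ hu0.ge hw huw ht⟩

theorem exists_isotropic [FiniteDimensional ℝ W] (hW : 1 < Module.rank ℝ W) {v w : W} (hv : v ≠ 0)
    (hβv : β v v ≤ 0) (hw : w ∈ puncturedNonneg β) : ∃ u : puncturedNonneg β, β u u = 0 := by
  have hcont : Continuous fun t => β t t :=
    QuadricFamily.continuous_bilinForm_apply β continuous_id continuous_id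
  obtain ⟨u, hu, hβu⟩ := (isConnected_compl_singleton_of_one_lt_rank hW 0).isPreconnected
    |>.intermediate_value hv hw.1 hcont.continuousOn ⟨hβv, hw.2⟩
  exact ⟨⟨u, hu, hβu.ge⟩, hβu⟩

theorem exists_isPreconnected_of_isotropic (hβ : β.IsSymm) (hf : Continuous f)
    {u : puncturedNonneg β} (hu : β u u = 0)
    (hfu : ∀ s (c : ℝ), c ≠ 0 → s.1 = c • u.1 → f s = f u) (w : puncturedNonneg β) :
    ∃ T ⊆ range f, f u ∈ T ∧ f w ∈ T ∧ IsPreconnected T := by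
  by_cases hpar : ∃ c : ℝ, w.1 = c • u.1
  · obtain ⟨c, hc⟩ := hpar
    have hc0 : c ≠ 0 := fun h => w.2.1 (by rw [hc, h, zero_smul])
    exact ⟨{f u}, singleton_subset_iff.mpr ⟨_, rfl⟩, rfl, hfu w c hc0 hc, isPreconnected_singleton⟩
  push Not at hpar
  obtain ⟨ε, hε, hεw⟩ : ∃ ε : ℝ, ε ≠ 0 ∧ 0 ≤ β (ε • u.1) w := by
    simp only [map_smul, LinearMap.smul_apply, smul_eq_mul]
    rcases le_total 0 (β u w) with h | h
    · exact ⟨1, one_ne_zero, by rwa [one_mul]⟩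
    · exact ⟨-1, neg_ne_zero.mpr one_ne_zero, by rwa [neg_one_mul, neg_nonneg]⟩
  have hsub : segment ℝ (ε • u.1) w ⊆ puncturedNonneg β :=
    segment_subset_puncturedNonneg hβ (smul_ne_zero hε u.2.1) (by simp [hu]) w.2.2 hεw
      fun c => by rw [smul_smul]; exact hpar _
  have := isPreconnected_iff_preconnectedSpace.mp
    (convex_segment (𝕜 := ℝ) (ε • u.1) w).isPreconnected
  exact ⟨_, range_comp_subset_range (inclusion hsub) f,
    ⟨⟨_, left_mem_segment ℝ _ _⟩, hfu _ ε hε rfl⟩, ⟨⟨_, right_mem_segment ℝ _ _⟩, rfl⟩,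
    isPreconnected_range (hf.comp (continuous_inclusion hsub))⟩

/- In the plane, the set where an indefinite form is nonnegative has two opposite components; they
are joined by `f` along the isotropic lines. -/
theorem isPreconnected_range_of_isotropic [FiniteDimensional ℝ W] (hβ : β.IsSymm)
    (hW : 1 < Module.rank ℝ W) (hf : Continuous f)
    (hfu : ∀ s u, β u.1 u.1 = 0 → ∀ c : ℝ, c ≠ 0 → s.1 = c • u.1 → f s = f u) :
    IsPreconnected (range f) := by
  by_cases hdef : ∀ t, t ≠ 0 → 0 < β t t
  · have hset : puncturedNonneg β = {0}ᶜ :=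
      ext fun t => ⟨And.left, fun ht => ⟨ht, (hdef t ht).le⟩⟩
    have := isPreconnected_iff_preconnectedSpace.mp
      (hset ▸ (isConnected_compl_singleton_of_one_lt_rank hW 0).isPreconnected)
    exact isPreconnected_range hf
  push Not at hdef
  obtain ⟨v, hv, hβv⟩ := hdef
  refine isPreconnected_of_forall_pair ?_
  rintro _ ⟨w, rfl⟩ _ ⟨w', rfl⟩
  obtain ⟨u, hu⟩ := exists_isotropic hW hv hβv w.2
  obtain ⟨T, hT, huT, hwT, hTc⟩ :=
    exists_isPreconnected_of_isotropic hβ hf hu (fun s => hfu s u hu) w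
  obtain ⟨T', hT', huT', hwT', hTc'⟩ :=
    exists_isPreconnected_of_isotropic hβ hf hu (fun s => hfu s u hu) w'
  exact ⟨T ∪ T', union_subset hT hT', Or.inl hwT, Or.inr hwT', hTc.union _ huT huT' hTc'⟩

end PuncturedNonneg

namespace QuadricFamily

variable (P : QuadricFamily (Fin 3 → ℝ))

/-- The value `q_t(x)` of the family at a fixed vector `x`, as a form in the parameter `t`. -/
noncomputable def fibreForm (x : Fin 3 → ℝ) : LinearMap.BilinForm ℝ (Fin 2 → ℝ) :=
  Matrix.toBilin' !![P.B₁ x x, P.B₂ x x; P.B₂ x x, P.B₃ x x]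

theorem isSymm_fibreForm (x : Fin 3 → ℝ) : (P.fibreForm x).IsSymm :=
  Matrix.isSymm_toBilin'_iff_isSymm.mpr (Matrix.IsSymm.ext fun i j => by
    fin_cases i <;> fin_cases j <;> rfl)

theorem fibreForm_self (x : Fin 3 → ℝ) (t : Fin 2 → ℝ) : P.fibreForm x t t = P.bilin t x x := by
  simp only [fibreForm, Matrix.toBilin'_apply, Fin.sum_univ_two, Matrix.of_apply, bilin_apply,
    Matrix.cons_val_zero, Matrix.cons_val_one, Matrix.cons_val', Matrix.cons_val_fin_one]
  ring

end QuadricFamily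

namespace DoubleCover

variable {Q₁ Q₂ Q₃ : MvPolynomial (Fin 3) ℝ} {P : QuadricFamily (Fin 3 → ℝ)}

/-- The projection of the double cover to the projective plane. -/
noncomputable def proj : DoubleCover Q₁ Q₂ Q₃ → RP2 :=
  Quotient.lift (fun p => Projectivization.mk ℝ p.1.2.1 p.2.2.1) fun p q ⟨_, b, _, h, _⟩ =>
    (Projectivization.mk_eq_mk_iff' ℝ _ _ _ _).mpr
      ⟨(b : ℝ)⁻¹, by rw [h, inv_smul_smul₀ b.ne_zero]⟩

theorem continuous_proj : Continuous (proj : DoubleCover Q₁ Q₂ Q₃ → RP2) :=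
  Continuous.quotient_lift (RP2.continuous_mk
    (continuous_fst.comp (continuous_snd.comp continuous_subtype_val)) fun p => p.2.2.1) _

/-- The point `(t, x, √q_t(x))` of the double cover. Since `(t, x, z)` and `(-t, x, -z)` are the
same point, these are all its points. -/
noncomputable def point (h : P.IsPolarization Q₁ Q₂ Q₃) {t : Fin 2 → ℝ} {x : Fin 3 → ℝ}
    (ht : t ≠ 0) (hx : x ≠ 0) (hq : 0 ≤ P.bilin t x x) : DoubleCover Q₁ Q₂ Q₃ :=
  Quotient.mk _ ⟨(t, x, √(P.bilin t x x)), ht, hx, by rw [Real.sq_sqrt hq, h.eval_eq_bilin]⟩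

section Point

variable (h : P.IsPolarization Q₁ Q₂ Q₃)
include h

theorem continuous_point {X : Type*} [TopologicalSpace X] {t : X → Fin 2 → ℝ} {x : X → Fin 3 → ℝ}
    (ht : Continuous t) (hx : Continuous x) (ht0 : ∀ a, t a ≠ 0) (hx0 : ∀ a, x a ≠ 0)
    (hq : ∀ a, 0 ≤ P.bilin (t a) (x a) (x a)) :
    Continuous fun a => point h (ht0 a) (hx0 a) (hq a) :=
  continuous_quot_mk.comp
    ((ht.prodMk (hx.prodMk (P.continuous_bilin ht hx hx).sqrt)).subtype_mk _)

theorem point_congr {s t : Fin 2 → ℝ} {x : Fin 3 → ℝ} {c : ℝ} (hc : c ≠ 0) (hst : s = c • t)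
    (hcq : 0 ≤ c ∨ P.bilin t x x = 0) (hs : s ≠ 0) (ht : t ≠ 0) (hx : x ≠ 0)
    (hqs : 0 ≤ P.bilin s x x) (hqt : 0 ≤ P.bilin t x x) :
    point h ht hx hqt = point h hs hx hqs := by
  refine Quotient.sound ⟨Units.mk0 c hc, 1, hst, (one_smul _ x).symm, ?_⟩
  change √(P.bilin s x x) = c * 1 * √(P.bilin t x x)
  rw [hst, P.bilin_smul, LinearMap.smul_apply, LinearMap.smul_apply, smul_eq_mul, mul_one]
  rcases hcq with hc | hq
  · rw [Real.sqrt_mul (sq_nonneg c), Real.sqrt_sq hc]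
  · rw [hq, mul_zero, Real.sqrt_zero, mul_zero]

theorem exists_point_eq_of_proj_eq {y : DoubleCover Q₁ Q₂ Q₃} {x : Fin 3 → ℝ} (hx : x ≠ 0)
    (hy : proj y = Projectivization.mk ℝ x hx) : ∃ t ht hq, y = point h (t := t) ht hx hq := by
  induction y using Quotient.ind with | _ p
  obtain ⟨⟨t, x', z⟩, ht, hx', hz⟩ := p
  obtain ⟨b, rfl⟩ := (Projectivization.mk_eq_mk_iff' ℝ _ _ hx hx').mp hy.symm
  have hb : b ≠ 0 := left_ne_zero_of_smul hx
  obtain ⟨a, ha, haz⟩ : ∃ a : ℝ, a ≠ 0 ∧ 0 ≤ a * b * z := by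
    rcases le_total 0 (b * z) with h | h
    · exact ⟨1, one_ne_zero, by rwa [one_mul]⟩
    · exact ⟨-1, neg_ne_zero.mpr one_ne_zero, by rwa [mul_assoc, neg_one_mul, neg_nonneg]⟩
  have hq : P.bilin (a • t) (b • x') (b • x') = (a * b * z) ^ 2 := by
    rw [mul_pow, hz, h.eval_eq_bilin, P.bilin_smul]
    simp only [LinearMap.smul_apply, map_smul, smul_eq_mul]
    ring
  refine ⟨a • t, smul_ne_zero ha ht, hq ▸ sq_nonneg _, ?_⟩
  exact Quotient.sound ⟨Units.mk0 a ha, Units.mk0 b hb, rfl, rfl,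
    (congrArg _ hq).trans (Real.sqrt_sq haz)⟩

theorem compactSpace : CompactSpace (DoubleCover Q₁ Q₂ Q₃) := by
  let K : Set (Metric.sphere (0 : Fin 2 → ℝ) 1 × Metric.sphere (0 : Fin 3 → ℝ) 1) :=
    {p | 0 ≤ P.bilin p.1 p.2 p.2}
  have hK : IsClosed K := isClosed_le continuous_const (by fun_prop)
  have := isCompact_iff_compactSpace.mp hK.isCompact
  have hpoint : Continuous fun p : K => point h (ne_zero_of_mem_unit_sphere p.1.1)
      (ne_zero_of_mem_unit_sphere p.1.2) p.2 :=
    continuous_point h (by fun_prop) (by fun_prop) _ _ _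
  refine Function.Surjective.compactSpace hpoint fun y => ?_
  obtain ⟨x, hxy⟩ := RP2.exists_unit_mk_eq (proj y)
  obtain ⟨t, ht, hq, rfl⟩ := exists_point_eq_of_proj_eq h _ hxy.symm
  have ht' := norm_ne_zero_iff.mpr ht
  refine ⟨⟨⟨⟨‖t‖⁻¹ • t, ?_⟩, x⟩, ?_⟩, ?_⟩
  · rw [mem_sphere_zero_iff_norm, norm_smul, norm_inv, norm_norm, inv_mul_cancel₀ ht']
  · rw [mem_ofPred_eq, P.bilin_smul]
    exact mul_nonneg (sq_nonneg _) hq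
  · exact (point_congr h (inv_ne_zero ht') rfl (Or.inl (by positivity)) _ _ _ _ _).symm

theorem isPreconnected_proj_preimage_singleton (p : RP2) :
    IsPreconnected (proj ⁻¹' {p} : Set (DoubleCover Q₁ Q₂ Q₃)) := by
  induction p using Projectivization.ind with | h x hx
  have hnonneg (t : puncturedNonneg (P.fibreForm x)) : 0 ≤ P.bilin t x x :=
    P.fibreForm_self x t ▸ t.2.2
  have hrange : range (fun t : puncturedNonneg (P.fibreForm x) => point h t.2.1 hx (hnonneg t)) =
      proj ⁻¹' {Projectivization.mk ℝ x hx} := by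
    ext y
    refine ⟨?_, fun hy => ?_⟩
    · rintro ⟨t, rfl⟩
      rfl
    · obtain ⟨t, ht, hq, rfl⟩ := exists_point_eq_of_proj_eq h hx hy
      exact ⟨⟨t, ht, (P.fibreForm_self x t).symm ▸ hq⟩, rfl⟩
  rw [← hrange]
  refine isPreconnected_range_of_isotropic (P.isSymm_fibreForm x) (by simp)
    (continuous_point h continuous_subtype_val continuous_const _ _ _) fun s u hu c hc hs => ?_
  rw [P.fibreForm_self] at hu
  exact (point_congr h hc hs (Or.inr hu) _ _ _ _ _).symm

end Point

end DoubleCover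

section ConeOver

/-- The cone over a set of points of the projective plane, including its vertex. -/
def coneOver (S : Set RP2) : Set (Fin 3 → ℝ) :=
  {x | ∀ hx : x ≠ 0, (Projectivization.mk ℝ x hx : RP2) ∈ S}

theorem projSet_coneOver (S : Set RP2) : projSet (coneOver S) = S := by
  ext p
  refine ⟨fun hp => ?_, fun hp _ => by rwa [p.mk_rep]⟩
  simpa only [p.mk_rep] using hp p.rep_nonzero

theorem isProjCone_coneOver {S : Set RP2} (hS : IsClosed S) : IsProjCone (coneOver S) where
  isClosed := by
    have hopen := isOpen_compl_singleton.isOpenMap_subtype_val _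
      (hS.isOpen_compl.preimage RP2.isQuotientMap_mk'.continuous)
    convert hopen.isClosed_compl using 1
    ext x
    refine ⟨?_, fun hx hx0 => not_not.mp fun hS => hx ⟨⟨x, hx0⟩, hS, rfl⟩⟩
    rintro hx ⟨⟨x, hx0⟩, hS, rfl⟩
    exact hS (hx hx0)
  smul_mem c x hx hcx := by
    have hx0 : x ≠ 0 := right_ne_zero_of_smul hcx
    rw [(Projectivization.mk_eq_mk_iff' ℝ _ _ hcx hx0).mpr ⟨c, rfl⟩]
    exact hx hx0

theorem conePartition_coneOver {ι : Type*} [Nonempty ι] {S : ι → Set RP2}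
    (hclosed : ∀ i, IsClosed (S i)) (hne : ∀ i, (S i).Nonempty)
    (hdisj : Pairwise (Function.onFun Disjoint S)) :
    ConePartition (coneOver (⋃ i, S i)) fun i => coneOver (S i) where
  isProjCone i := isProjCone_coneOver (hclosed i)
  eq_zero i j hij x hi hj := by
    by_contra hx
    exact (hdisj hij).notMem_of_mem_left (hi hx) (hj hx)
  iUnion := by
    ext x
    rw [mem_iUnion]
    by_cases hx : x = 0
    · exact iff_of_true ⟨Classical.arbitrary ι, fun h => absurd hx h⟩ fun h => absurd hx h
    · refine ⟨fun ⟨i, hi⟩ h => mem_iUnion.mpr ⟨i, hi h⟩, fun h => ?_⟩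
      obtain ⟨i, hi⟩ := mem_iUnion.mp (h hx)
      exact ⟨i, fun _ => hi⟩
  nontrivial i := by
    obtain ⟨p, hp⟩ := hne i
    exact ⟨p.rep, fun _ => by rwa [p.mk_rep], p.rep_nonzero⟩

end ConeOver

namespace DoubleCover

variable {Q₁ Q₂ Q₃ : MvPolynomial (Fin 3) ℝ}

theorem nontrivial_connectedComponents (hY : ¬ PreconnectedSpace (DoubleCover Q₁ Q₂ Q₃)) :
    Nontrivial (ConnectedComponents (DoubleCover Q₁ Q₂ Q₃)) := by
  by_contra hsub
  have := not_nontrivial_iff_subsingleton.mp hsub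
  exact hY ⟨isPreconnected_of_forall_pair fun x _ y _ => ⟨connectedComponent y, subset_univ _,
    ConnectedComponents.coe_eq_coe'.mp (Subsingleton.elim _ _), mem_connectedComponent,
    isPreconnected_connectedComponent⟩⟩

/-- The cone over the projection of a connected component of the double cover. -/
def componentCone (c : ConnectedComponents (DoubleCover Q₁ Q₂ Q₃)) : Set (Fin 3 → ℝ) :=
  coneOver (proj '' (ConnectedComponents.mk ⁻¹' {c}))

theorem isConnected_projSet_componentCone (c : ConnectedComponents (DoubleCover Q₁ Q₂ Q₃)) :
    IsConnected (projSet (componentCone c)) := by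
  obtain ⟨y, rfl⟩ := ConnectedComponents.surjective_coe c
  rw [componentCone, projSet_coneOver, connectedComponents_preimage_singleton]
  exact isConnected_connectedComponent.image proj continuous_proj.continuousOn

variable {P : QuadricFamily (Fin 3 → ℝ)} (h : P.IsPolarization Q₁ Q₂ Q₃)
include h

theorem coneOver_range_proj :
    coneOver (range (proj : DoubleCover Q₁ Q₂ Q₃ → RP2)) = P.base := by
  ext x
  by_cases hx : x = 0
  · exact iff_of_true (fun h => absurd hx h)
      (P.mem_base_of_discr_nonpos (hx ▸ P.discr_zero.le))
  · refine ⟨fun hmem => ?_, fun ⟨t, ht, hq⟩ hx => ⟨point h ht hx hq, rfl⟩⟩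
    obtain ⟨y, hy⟩ := hmem hx
    obtain ⟨t, ht, hq, -⟩ := exists_point_eq_of_proj_eq h hx hy
    exact ⟨t, ht, hq⟩

theorem conePartition {ι : Type*} [Nonempty ι] {U : ι → Set (DoubleCover Q₁ Q₂ Q₃)}
    (hclopen : ∀ i, IsClopen (U i)) (hne : ∀ i, (U i).Nonempty)
    (hdisj : Pairwise (Function.onFun Disjoint U)) (hU : ⋃ i, U i = univ) :
    ConePartition P.base fun i => coneOver (proj '' U i) := by
  have := compactSpace h
  have hpart := conePartition_coneOver
    (fun i => ((hclopen i).isClosed.isCompact.image continuous_proj).isClosed)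
    (fun i => (hne i).image proj) fun i j hij => disjoint_left.mpr ?_
  · rwa [← image_iUnion, hU, image_univ, coneOver_range_proj h] at hpart
  · rintro _ ⟨y, hy, rfl⟩ ⟨y', hy', hyy'⟩
    have hfibre := (isPreconnected_proj_preimage_singleton h (proj y)).subset_isClopen (hclopen i)
      ⟨y, rfl, hy⟩
    exact (hdisj hij).notMem_of_mem_left (hfibre hyy') hy'

theorem finite_connectedComponents (hP : P.Smooth) :
    Finite (ConnectedComponents (DoubleCover Q₁ Q₂ Q₃)) := by
  by_contra hinf
  have := not_finite_iff_infinite.mp hinf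
  obtain ⟨U, hclopen, hne, hdisj, hU⟩ :=
    ConnectedComponents.exists_fun_isClopen_of_infinite (DoubleCover Q₁ Q₂ Q₃) 4 four_pos
  have hcard := hP.card_le_finrank (conePartition h hclopen hne hdisj hU)
  simp at hcard

theorem conePartition_componentCone [Finite (ConnectedComponents (DoubleCover Q₁ Q₂ Q₃))]
    [Nonempty (ConnectedComponents (DoubleCover Q₁ Q₂ Q₃))] :
    ConePartition P.base (componentCone (Q₁ := Q₁) (Q₂ := Q₂) (Q₃ := Q₃)) :=
  conePartition h (fun _ => (isClopen_discrete _).preimage ConnectedComponents.continuous_coe)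
    (fun _ => (singleton_nonempty _).preimage ConnectedComponents.surjective_coe)
    (fun _ _ hij => (disjoint_singleton.mpr hij).preimage _)
    (by rw [← preimage_iUnion, iUnion_of_singleton, preimage_univ])

theorem conePartition_discr_nonpos [Finite (ConnectedComponents (DoubleCover Q₁ Q₂ Q₃))]
    [Nontrivial (ConnectedComponents (DoubleCover Q₁ Q₂ Q₃))] :
    ConePartition {x | P.discr x ≤ 0} (componentCone (Q₁ := Q₁) (Q₂ := Q₂) (Q₃ := Q₃)) := by
  have hpart := conePartition_componentCone h
  rwa [QuadricFamily.base_eq_of_conePartition hpart] at hpart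

theorem card_connectedComponents_le (hP : P.Smooth)
    [Nontrivial (ConnectedComponents (DoubleCover Q₁ Q₂ Q₃))] :
    Nat.card (ConnectedComponents (DoubleCover Q₁ Q₂ Q₃)) ≤ 3 := by
  have := finite_connectedComponents h hP
  have := Fintype.ofFinite (ConnectedComponents (DoubleCover Q₁ Q₂ Q₃))
  rw [Nat.card_eq_fintype_card, ← Module.finrank_fin_fun ℝ (n := 3)]
  exact hP.card_le_finrank (conePartition_componentCone h)

theorem isNonNestedOvals_of_card_eq_three (hP : P.Smooth)
    (hcard : Nat.card (ConnectedComponents (DoubleCover Q₁ Q₂ Q₃)) = 3) :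
    IsNonNestedOvals 3 (realLocus (discrForm Q₁ Q₂ Q₃)) := by
  have := Nat.finite_of_card_ne_zero (hcard.trans_ne three_ne_zero)
  have : Nontrivial (ConnectedComponents (DoubleCover Q₁ Q₂ Q₃)) :=
    Finite.one_lt_card_iff_nontrivial.mp (by rw [hcard]; norm_num)
  have hovals := (conePartition_discr_nonpos h).isNonNestedOvals_of_two_lt hP
    isConnected_projSet_componentCone (by rw [hcard]; norm_num)
  rwa [hcard, ← h.realLocus_discrForm] at hovals

theorem isNonNestedOvals_or_isTwoNestedOvals_of_card_eq_two (hP : P.Smooth)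
    (hcard : Nat.card (ConnectedComponents (DoubleCover Q₁ Q₂ Q₃)) = 2) :
    IsNonNestedOvals 2 (realLocus (discrForm Q₁ Q₂ Q₃)) ∨
      IsTwoNestedOvals (realLocus (discrForm Q₁ Q₂ Q₃)) := by
  have := Nat.finite_of_card_ne_zero (hcard.trans_ne two_ne_zero)
  have : Nontrivial (ConnectedComponents (DoubleCover Q₁ Q₂ Q₃)) :=
    Finite.one_lt_card_iff_nontrivial.mp (by rw [hcard]; norm_num)
  rw [h.realLocus_discrForm]
  exact (conePartition_discr_nonpos h).isNonNestedOvals_or_isTwoNestedOvals hP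
    isConnected_projSet_componentCone hcard

end DoubleCover

theorem corollary2p8_general (Q₁ Q₂ Q₃ : MvPolynomial (Fin 3) ℝ)
    (hQ₁ : Q₁.IsHomogeneous 2) (hQ₂ : Q₂.IsHomogeneous 2) (hQ₃ : Q₃.IsHomogeneous 2)
    (hΔ : ∀ p, p ≠ 0 → MvPolynomial.eval p (discrForm Q₁ Q₂ Q₃) = 0 →
      ∃ i, MvPolynomial.eval p (MvPolynomial.pderiv i (discrForm Q₁ Q₂ Q₃)) ≠ 0) :
    (¬ PreconnectedSpace (DoubleCover Q₁ Q₂ Q₃) →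
      IsNonNestedOvals 2 (realLocus (discrForm Q₁ Q₂ Q₃)) ∨
      IsTwoNestedOvals (realLocus (discrForm Q₁ Q₂ Q₃)) ∨
      IsNonNestedOvals 3 (realLocus (discrForm Q₁ Q₂ Q₃))) ∧
    (Nat.card (ConnectedComponents (DoubleCover Q₁ Q₂ Q₃)) = 3 →
      IsNonNestedOvals 3 (realLocus (discrForm Q₁ Q₂ Q₃))) ∧
    (Nat.card (ConnectedComponents (DoubleCover Q₁ Q₂ Q₃)) = 2 →
      IsNonNestedOvals 2 (realLocus (discrForm Q₁ Q₂ Q₃)) ∨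
      IsTwoNestedOvals (realLocus (discrForm Q₁ Q₂ Q₃))) := by
  have h := QuadricFamily.isPolarization_ofPolynomials hQ₁ hQ₂ hQ₃
  have hP := QuadricFamily.smooth_ofPolynomials hQ₁ hQ₂ hQ₃ hΔ
  have hthree := DoubleCover.isNonNestedOvals_of_card_eq_three h hP
  have htwo := DoubleCover.isNonNestedOvals_or_isTwoNestedOvals_of_card_eq_two h hP
  refine ⟨fun hY => ?_, hthree, htwo⟩
  have := DoubleCover.finite_connectedComponents h hP
  have := DoubleCover.nontrivial_connectedComponents hY
  have hle := DoubleCover.card_connectedComponents_le h hP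
  have hlt := Finite.one_lt_card (α := ConnectedComponents (DoubleCover Q₁ Q₂ Q₃))
  obtain hcard | hcard := eq_or_lt_of_le (Nat.succ_le_of_lt hlt)
  · exact (htwo hcard.symm).imp_right Or.inl
  · exact Or.inr (Or.inr (hthree (hle.antisymm hcard)))

theorem corollary2p8 (Q₁ Q₂ Q₃ : MvPolynomial (Fin 3) ℝ)
    (hQ₁ : Q₁.IsHomogeneous 2) (hQ₂ : Q₂.IsHomogeneous 2) (hQ₃ : Q₃.IsHomogeneous 2)
    (hΔ : IsSmoothPlaneCurve (discrForm Q₁ Q₂ Q₃)) :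
    (¬ PreconnectedSpace (DoubleCover Q₁ Q₂ Q₃) →
      IsNonNestedOvals 2 (realLocus (discrForm Q₁ Q₂ Q₃)) ∨
      IsTwoNestedOvals (realLocus (discrForm Q₁ Q₂ Q₃)) ∨
      IsNonNestedOvals 3 (realLocus (discrForm Q₁ Q₂ Q₃))) ∧
    (Nat.card (ConnectedComponents (DoubleCover Q₁ Q₂ Q₃)) = 3 →
      IsNonNestedOvals 3 (realLocus (discrForm Q₁ Q₂ Q₃))) ∧
    (Nat.card (ConnectedComponents (DoubleCover Q₁ Q₂ Q₃)) = 2 →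
      IsNonNestedOvals 2 (realLocus (discrForm Q₁ Q₂ Q₃)) ∨
      IsTwoNestedOvals (realLocus (discrForm Q₁ Q₂ Q₃))) :=
  corollary2p8_general Q₁ Q₂ Q₃ hQ₁ hQ₂ hQ₃ fun _ => hΔ.exists_eval_pderiv_ne_zero
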